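/- Let $n\ge 0$ and let $\Gamma$ be a discrete, cocompact, torsion-free subgroup of $\mathrm{Isom}(\mathbf E^n)$, so that $M=\mathbf E^n/\Gamma$ is a closed flat $n$-manifold. For $g\in\Gamma$ let $\theta(g)$ be its linear part, $\theta(g)x=g(x)-g(0)$. For a rational quadratic form $q$ in $m+1$ variables of signature $(m,1)$, with symmetric matrix $Q$, let $O_0(q;\mathbf Z)$ be the group of all $X\in \mathrm{GL}(m+1,\mathbf Z)$ with $X^TQX=Q$ which map each of the two sheets (connected components) of the real hyperboloid $q=-1$ to itself. Then for every base point $x\in M$ there are a quadratic form $q_{n+2}$ over $\mathbf Q$ in $n+2$ variables of signature $(n+1,1)$, with symmetric matrix $Q$, and an injective homomorphism $\rho:\pi_1(M,x)\to O_0(q_{n+2};\mathbf Z)$ whose image fixes a light-like vector, i.e. a non-zero $v\in\mathbf Z^{n+2}$ with $q_{n+2}(v)=0$. Moreover, $q_{n+2}$ and $\rho$ can be chosen so that there exist an isomorphism $e:\pi_1(M,x)\to\Gamma$, a $\mathbf Z$-basis $b$ of the lattice of translations in $\Gamma$ that is also an $\mathbf R$-basis of $\mathbf E^n$, a point $c\in\mathbf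 E^n$, an integer $N\ge 1$ and a positive definite symmetric rational $n\times n$ matrix $D$ with the following properties, where $A_g$ denotes the matrix of $\theta(g)$ in the basis $b$ and $t_g$ the coordinate vector of $g(c)-c$ in the basis $b$. 1. For all $g\in\Gamma$ the matrix $\Phi^*(g)=\begin{pmatrix}A_g & N t_g\\ 0&1\end{pmatrix}$ has integer entries, and $\Phi^*:\Gamma\to \mathrm{GL}(n+1,\mathbf Z)$ is a homomorphism. 2. $D$ is invariant under the transposed holonomy: $A_g D A_g^T=D$ for all $g\in\Gamma$. 3. $Q$ is equivalent over $\mathbf Q$ to $D\oplus H_2$, where $H_2=\begin{pmatrix}0&1\\1&0\end{pmatrix}$ is the hyperbolic plane; that is, $P^TQP=D\oplus H_2$ for some $P\in \mathrm{GL}(n+2,\mathbf Q)$. 4. For all $g\in\pi_1(M,x)$, the matrix $\rho(g)$ has the form $\begin{pmatrix}(\Phi^*(e(g))^{-1})^T & *\\ 0&1\end{pmatrix}$, with blocks of sizes $n+1$ and $1$. -/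

import Mathlib

open scoped Matrix

noncomputable section

/-- Euclidean `n`-space. -/
abbrev Euc (n : ℕ) : Type := EuclideanSpace ℝ (Fin n)

/-- The isometry group of Euclidean `n`-space (multiplication is composition). -/
abbrev EucIsom (n : ℕ) : Type := Euc n ≃ᵢ Euc n

/-- The tautological action of the isometry group on Euclidean space. -/
instance eucIsomMulAction (n : ℕ) : MulAction (EucIsom n) (Euc n) where
  smul g x := g x
  one_smul _ := rfl
  mul_smul _ _ _ := rfl

/-- The compact-open topology on the isometry group. -/
instance eucIsomTopologicalSpace (n : ℕ) : TopologicalSpace (EucIsom n) :=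
  TopologicalSpace.induced
    (fun g => (⟨fun x => g x, g.continuous⟩ : C(Euc n, Euc n))) inferInstance

/-- The orbit space `Eⁿ / Γ`, with the quotient topology. -/
abbrev OrbitSpace {n : ℕ} (Γ : Subgroup (EucIsom n)) : Type :=
  Quotient (MulAction.orbitRel Γ (Euc n))

/-- `Γ` is a discrete, cocompact, torsion-free subgroup of `Isom(Eⁿ)`, so that `Eⁿ / Γ` is a
closed flat `n`-manifold. -/
structure IsBieberbachGroup {n : ℕ} (Γ : Subgroup (EucIsom n)) : Prop where
  discrete : IsDiscrete (Γ : Set (EucIsom n))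
  cocompact : CompactSpace (OrbitSpace Γ)
  torsionFree : ∀ g ∈ Γ, IsOfFinOrder g → g = 1

/-- The linear part `θ(g)` of the isometry `g`, i.e. `θ(g) x = g x - g 0`. -/
def linearPart {n : ℕ} (g : EucIsom n) : Euc n →ₗ[ℝ] Euc n :=
  (g.toRealLinearIsometryEquiv.toLinearEquiv : Euc n →ₗ[ℝ] Euc n)

/-- `b` is a `ℤ`-basis of the lattice of translations contained in `Γ`. -/
def IsTranslationBasis {n : ℕ} (Γ : Subgroup (EucIsom n))
    (b : Module.Basis (Fin n) ℝ (Euc n)) : Prop :=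
  ∀ t : Euc n, t ∈ Submodule.span ℤ (Set.range b) ↔ ∃ g ∈ Γ, ∀ x, g x = x + t

/-- The matrix `(A, N t; 0, 1)`, where `A` is the matrix of the linear part of `g` in the basis `b`
and `t` is the coordinate vector of `g c - c`. For `N ≠ 0` this is the matrix of the affine map `g`
in the affine coordinates with origin `c` and coordinate vectors `b i / N`. -/
def affineMatrix {n : ℕ} (b : Module.Basis (Fin n) ℝ (Euc n)) (c : Euc n) (N : ℕ)
    (g : EucIsom n) : Matrix (Fin n ⊕ Fin 1) (Fin n ⊕ Fin 1) ℝ :=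
  Matrix.fromBlocks (LinearMap.toMatrix b b (linearPart g))
    (Matrix.of fun i _ => (N : ℝ) * b.repr (g c - c) i) 0 1

section Forms

variable {ι : Type} [Fintype ι] [DecidableEq ι]

/-- Two rational quadratic forms, given by their symmetric matrices, are equivalent over `ℚ`. -/
def RatEquivalent (F Q : Matrix ι ι ℚ) : Prop :=
  ∃ P : GL ι ℚ, (P : Matrix ι ι ℚ)ᵀ * F * (P : Matrix ι ι ℚ) = Q

/-- The quadratic form with symmetric matrix `F` is nondegenerate of signature `(p, q)`. -/
def HasSignature (F : Matrix ι ι ℚ) (p q : ℕ) : Prop :=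
  Fintype.card ι = p + q ∧ sigPos F.toQuadraticForm' = p ∧
    sigNeg F.toQuadraticForm' = q

/-- The orthogonal group `O(F; ℝ)`. -/
def realOrthogonal (F : Matrix ι ι ℝ) : Subgroup (GL ι ℝ) where
  carrier := {X | (X : Matrix ι ι ℝ)ᵀ * F * (X : Matrix ι ι ℝ) = F}
  one_mem' := by simp
  mul_mem' := by
    intro X Y hX hY
    simp only [Set.mem_ofPred_eq] at hX hY ⊢
    rw [Matrix.GeneralLinearGroup.coe_mul, Matrix.transpose_mul]
    calc _ = (Y : Matrix ι ι ℝ)ᵀ * ((X : Matrix ι ι ℝ)ᵀ * F * (X : Matrix ι ι ℝ))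
          * (Y : Matrix ι ι ℝ) := by simp only [Matrix.mul_assoc]
      _ = F := by rw [hX, hY]
  inv_mem' := by
    intro X hX
    simp only [Set.mem_ofPred_eq] at hX ⊢
    have h1 : (X : Matrix ι ι ℝ) * ((X⁻¹ : GL ι ℝ) : Matrix ι ι ℝ) = 1 := by
      rw [← Matrix.GeneralLinearGroup.coe_mul]; simp
    have h2 : ((X⁻¹ : GL ι ℝ) : Matrix ι ι ℝ)ᵀ * (X : Matrix ι ι ℝ)ᵀ = 1 := by
      rw [← Matrix.transpose_mul, h1, Matrix.transpose_one]
    calc _ = ((X⁻¹ : GL ι ℝ) : Matrix ι ι ℝ)ᵀ *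
          ((X : Matrix ι ι ℝ)ᵀ * F * (X : Matrix ι ι ℝ)) *
            ((X⁻¹ : GL ι ℝ) : Matrix ι ι ℝ) := by rw [hX]
      _ = (((X⁻¹ : GL ι ℝ) : Matrix ι ι ℝ)ᵀ * (X : Matrix ι ι ℝ)ᵀ) * F *
          ((X : Matrix ι ι ℝ) * ((X⁻¹ : GL ι ℝ) : Matrix ι ι ℝ)) := by
            simp only [Matrix.mul_assoc]
      _ = F := by rw [h1, h2, Matrix.one_mul, Matrix.mul_one]

/-- The hyperboloid `F(x) = -1`. -/
def hyperboloid (F : Matrix ι ι ℝ) : Set (ι → ℝ) := {x | x ⬝ᵥ (F *ᵥ x) = -1}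

lemma realOrthogonal_mulVec_mem {F : Matrix ι ι ℝ} {X : GL ι ℝ} (hX : X ∈ realOrthogonal F)
    {x : ι → ℝ} (hx : x ∈ hyperboloid F) : (X : Matrix ι ι ℝ) *ᵥ x ∈ hyperboloid F := by
  have hX' : (X : Matrix ι ι ℝ)ᵀ * F * (X : Matrix ι ι ℝ) = F := hX
  have hx' : x ⬝ᵥ (F *ᵥ x) = -1 := hx
  change ((X : Matrix ι ι ℝ) *ᵥ x) ⬝ᵥ (F *ᵥ ((X : Matrix ι ι ℝ) *ᵥ x)) = -1
  rw [← hx']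
  conv_rhs => rw [← hX']
  rw [← Matrix.mulVec_mulVec, ← Matrix.mulVec_mulVec, Matrix.dotProduct_mulVec x,
    Matrix.vecMul_transpose]

/-- The group `O₀(F; ℝ)` of a form of signature `(m, 1)`: the elements of `O(F; ℝ)` that map each
sheet (connected component) of the hyperboloid `F(x) = -1` to itself. It acts on the upper sheet as
the full isometry group of hyperbolic `m`-space. -/
def realOrthogonalZero (F : Matrix ι ι ℝ) : Subgroup (GL ι ℝ) where
  carrier := {X | X ∈ realOrthogonal F ∧ ∀ x ∈ hyperboloid F,
    (X : Matrix ι ι ℝ) *ᵥ x ∈ connectedComponentIn (hyperboloid F) x}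
  one_mem' := ⟨one_mem _, fun x hx => by simpa using mem_connectedComponentIn hx⟩
  mul_mem' := by
    rintro X Y ⟨hX, hX'⟩ ⟨hY, hY'⟩
    refine ⟨mul_mem hX hY, fun x hx => ?_⟩
    rw [Matrix.GeneralLinearGroup.coe_mul, ← Matrix.mulVec_mulVec,
      connectedComponentIn_eq (hY' x hx)]
    exact hX' _ (realOrthogonal_mulVec_mem hY hx)
  inv_mem' := by
    rintro X ⟨hX, hX'⟩
    refine ⟨inv_mem hX, fun x hx => ?_⟩
    have hy := realOrthogonal_mulVec_mem (inv_mem hX) hx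
    have h := hX' _ hy
    rw [Matrix.mulVec_mulVec, ← Matrix.GeneralLinearGroup.coe_mul, mul_inv_cancel,
      Units.val_one, Matrix.one_mulVec] at h
    rw [← connectedComponentIn_eq h]
    exact mem_connectedComponentIn hy

/-- The group `O₀(F; ℤ)` of integral points: the matrices in `GL(ℤ)` that lie in `O₀(F; ℝ)`. -/
def integralOrthogonalZero (F : Matrix ι ι ℚ) : Subgroup (GL ι ℤ) :=
  (realOrthogonalZero (F.map ((↑) : ℚ → ℝ))).comap
    (Matrix.GeneralLinearGroup.map (Int.castRingHom ℝ))

end Forms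

/-- The form `D ⊕ H₂`, where `H₂` is the hyperbolic plane `2XY`. -/
def sumHyperbolicPlane {n : ℕ} (D : Matrix (Fin n) (Fin n) ℚ) :
    Matrix (Fin n ⊕ Fin 2) (Fin n ⊕ Fin 2) ℚ :=
  Matrix.fromBlocks D 0 0 !![0, 1; 1, 0]

/-- `D` is invariant under the transposes of the holonomy matrices of `Γ` in the basis `b`. -/
def IsHolonomyInvariant {n : ℕ} (Γ : Subgroup (EucIsom n))
    (b : Module.Basis (Fin n) ℝ (Euc n)) (D : Matrix (Fin n) (Fin n) ℚ) : Prop :=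
  ∀ g ∈ Γ, LinearMap.toMatrix b b (linearPart g) * D.map ((↑) : ℚ → ℝ) *
    (LinearMap.toMatrix b b (linearPart g))ᵀ = D.map ((↑) : ℚ → ℝ)

/-- The inclusion of the first `n + 1` of the `n + 2` coordinates. -/
def firstCoords (n : ℕ) : Fin n ⊕ Fin 1 → Fin n ⊕ Fin 2 :=
  Sum.map id (fun _ => 0)

end

noncomputable section

/-! ### Bieberbach's first theorem -/

section Separated

/-! By Bieberbach's first theorem the translations in Γ form a full lattice and the holonomy group
is finite. In lattice coordinates the linear parts are integral matrices `A g`, and F = ∑ hᵀh over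
the holonomy is an invariant positive definite integral form. A suitable origin
(`exists_smul_apply_sub_mem_translationLattice`) makes the translation parts, multiplied by the
order N of the holonomy group, an integral cocycle τ. This gives Φ = (A, τ; 0, 1).

Put D = (2F)⁻¹. The contragredient of Φ extends to an isometry of D ⊕ H₂ whose remaining entries are
2Fτ(g) and -τ(g)ᵀFτ(g), both integral (`lorentzHom`, `lorentzHom_mem`). It fixes a light-like basis
vector and preserves the last coordinate, which is the pairing with that vector. The last coordinate
never vanishes on the hyperboloid and its level sets there are connected, so each sheet is preserved
(`mem_connectedComponentIn_hyperboloid`). Injectivity is inherited from Φ, which occurs as a block.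
Since Γ acts freely and properly discontinuously, π₁(M) ≅ Γ.

Bieberbach's theorem rests on `linPart_eq_one_of_norm_sub_one_le`, proved by a minimality argument
with commutators: a small rotation in Γ, commuted with an element that moves the origin mainly in
the directions it rotates most, would produce a shorter element of the same kind. As cocompactness
supplies elements with nearly trivial linear part translating in nearly any direction, the
translations span (`span_translationLattice`), and the linear parts are uniformly separated, hence
finite in number (`finite_image_linPart`). -/

lemma finite_of_isBounded_of_separated {X : Type*} [PseudoMetricSpace X] [ProperSpace X] {S : Set X}
    (hS : Bornology.IsBounded S) {δ : ℝ} (hδ : 0 < δ)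
    (hsep : ∀ x ∈ S, ∀ y ∈ S, dist x y < δ → x = y) : S.Finite := by
  obtain ⟨t, ht, hcov⟩ := Metric.totallyBounded_iff.1 ((Metric.isCompact_of_isClosed_isBounded
    isClosed_closure hS.closure).totallyBounded.subset subset_closure) (δ / 2) (by positivity)
  have hfin : (⋃ y ∈ t, S ∩ Metric.ball y (δ / 2)).Finite := by
    refine ht.biUnion fun y _ => Set.Subsingleton.finite ?_
    rintro a ⟨ha, ha'⟩ b ⟨hb, hb'⟩
    refine hsep a ha b hb ?_
    have := dist_triangle_right a b y
    rw [Metric.mem_ball] at ha' hb'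
    linarith
  refine hfin.subset fun x hx => ?_
  obtain ⟨y, hy, hxy⟩ := Set.mem_iUnion₂.1 (hcov hx)
  exact Set.mem_iUnion₂.2 ⟨y, hy, hx, hxy⟩

end Separated

/-! ### Linear parts of isometries of a normed space -/

namespace IsometryEquiv

variable {E : Type*} [NormedAddCommGroup E] [NormedSpace ℝ E]

/-- The linear part of a self-isometry of a normed space, as a continuous linear map. -/
def linPart (g : E ≃ᵢ E) : E →L[ℝ] E :=
  (g.toRealLinearIsometryEquiv.toContinuousLinearEquiv : E →L[ℝ] E)

lemma linPart_apply (g : E ≃ᵢ E) (x : E) : g.linPart x = g x - g 0 :=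
  g.toRealLinearIsometryEquiv_apply x

lemma apply_eq_linPart_add (g : E ≃ᵢ E) (x : E) : g x = g.linPart x + g 0 := by
  simp [linPart_apply]

lemma apply_add (g : E ≃ᵢ E) (x y : E) : g (x + y) = g x + g.linPart y := by
  rw [apply_eq_linPart_add g (x + y), apply_eq_linPart_add g x, map_add]
  abel

lemma apply_sub_apply (g : E ≃ᵢ E) (x y : E) : g x - g y = g.linPart (x - y) := by
  rw [map_sub, linPart_apply, linPart_apply]
  abel

lemma norm_linPart_apply (g : E ≃ᵢ E) (x : E) : ‖g.linPart x‖ = ‖x‖ :=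
  g.toRealLinearIsometryEquiv.norm_map x

lemma norm_apply_sub_apply (g : E ≃ᵢ E) (x y : E) : ‖g x - g y‖ = ‖x - y‖ := by
  rw [apply_sub_apply, norm_linPart_apply]

@[simp] lemma linPart_one : (1 : E ≃ᵢ E).linPart = 1 := by
  ext x
  simp [linPart_apply]

@[simp] lemma linPart_mul (g h : E ≃ᵢ E) : (g * h).linPart = g.linPart * h.linPart := by
  ext x
  rw [mul_apply_eq_comp, linPart_apply (g * h), mul_apply, mul_apply, apply_sub_apply,
    linPart_apply h]

lemma linPart_mul_linPart_inv (g : E ≃ᵢ E) : g.linPart * g⁻¹.linPart = 1 := by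
  rw [← linPart_mul, mul_inv_cancel, linPart_one]

lemma linPart_inv_mul_linPart (g : E ≃ᵢ E) : g⁻¹.linPart * g.linPart = 1 := by
  rw [← linPart_mul, inv_mul_cancel, linPart_one]

lemma linPart_linPart_inv_apply (g : E ≃ᵢ E) (x : E) : g.linPart (g⁻¹.linPart x) = x :=
  congr($(linPart_mul_linPart_inv g) x)

lemma norm_linPart_mul (g : E ≃ᵢ E) (T : E →L[ℝ] E) : ‖g.linPart * T‖ = ‖T‖ :=
  LinearIsometry.norm_toContinuousLinearMap_comp g.toRealLinearIsometryEquiv.toLinearIsometry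

lemma norm_mul_linPart (g : E ≃ᵢ E) (T : E →L[ℝ] E) : ‖T * g.linPart‖ = ‖T‖ :=
  T.opNorm_comp_linearIsometryEquiv g.toRealLinearIsometryEquiv

lemma norm_linPart_le (g : E ≃ᵢ E) : ‖g.linPart‖ ≤ 1 :=
  ContinuousLinearMap.opNorm_le_bound _ zero_le_one fun x => by rw [norm_linPart_apply, one_mul]

lemma inv_apply_zero (g : E ≃ᵢ E) : g⁻¹ 0 = -g⁻¹.linPart (g 0) := by
  rw [linPart_apply, inv_apply_self]
  abel

lemma norm_inv_apply_zero (g : E ≃ᵢ E) : ‖g⁻¹ 0‖ = ‖g 0‖ := by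
  rw [inv_apply_zero, norm_neg, norm_linPart_apply]

/-- An isometry is a translation iff its linear part is trivial. -/
lemma linPart_eq_one_iff {g : E ≃ᵢ E} : g.linPart = 1 ↔ ∀ x, g x = x + g 0 := by
  refine ⟨fun h x => by rw [apply_eq_linPart_add, h]; rfl, fun h => ?_⟩
  ext x
  rw [linPart_apply, h x]
  simp

lemma ext_linPart {g h : E ≃ᵢ E} (h₁ : g.linPart = h.linPart) (h₀ : g 0 = h 0) : g = h := by
  ext x
  rw [apply_eq_linPart_add, h₁, h₀, ← apply_eq_linPart_add]

end IsometryEquiv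

open IsometryEquiv

/-- Discreteness, in the form of finiteness below every bound, lets a descent on ‖g 0‖ terminate;
both extremal choices in `linPart_eq_one_of_norm_sub_one_le` come from here. -/
lemma exists_min_norm_apply_zero {E : Type*} [NormedAddCommGroup E] {Γ : Subgroup (E ≃ᵢ E)}
    (hfin : ∀ R : ℝ, {g : E ≃ᵢ E | g ∈ Γ ∧ ‖g 0‖ ≤ R}.Finite) (P : (E ≃ᵢ E) → Prop)
    (hP : ∃ g ∈ Γ, P g) :
    ∃ g ∈ Γ, P g ∧ ∀ h ∈ Γ, P h → ‖g 0‖ ≤ ‖h 0‖ := by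
  obtain ⟨g₀, hg₀, hPg₀⟩ := hP
  have hs : {g : E ≃ᵢ E | g ∈ Γ ∧ P g ∧ ‖g 0‖ ≤ ‖g₀ 0‖}.Finite :=
    (hfin ‖g₀ 0‖).subset fun g hg => ⟨hg.1, hg.2.2⟩
  obtain ⟨g, ⟨hg, hPg, hle⟩, hmin⟩ :=
    Set.exists_min_image _ (fun g : E ≃ᵢ E => ‖g 0‖) hs ⟨g₀, hg₀, hPg₀, le_rfl⟩
  refine ⟨g, hg, hPg, fun h hh hPh => ?_⟩
  rcases le_total ‖h 0‖ ‖g₀ 0‖ with hc | hc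
  · exact hmin h ⟨hh, hPh, hc⟩
  · exact hle.trans hc

/-! ### Compactness arguments and maximal displacement -/

section Bieberbach

variable {E : Type*} [NormedAddCommGroup E] [InnerProductSpace ℝ E] [FiniteDimensional ℝ E]

/-- If the identity is isolated in a group of isometries of a finite-dimensional space, only
finitely many elements move the origin by a bounded amount. -/
lemma finite_norm_apply_zero_le (Γ : Subgroup (E ≃ᵢ E)) {δ : ℝ} (hδ : 0 < δ)
    (hdisc : ∀ g ∈ Γ, ‖g.linPart - 1‖ < δ → ‖g 0‖ < δ → g = 1) (R : ℝ) :
    {g : E ≃ᵢ E | g ∈ Γ ∧ ‖g 0‖ ≤ R}.Finite := by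
  let f : (E ≃ᵢ E) → (E →L[ℝ] E) × E := fun g => (g.linPart, g 0)
  have hf : Function.Injective f := fun g h hgh =>
    ext_linPart (congrArg Prod.fst hgh) (congrArg Prod.snd hgh)
  refine Set.Finite.of_finite_image (f := f) ?_ hf.injOn
  have : ProperSpace (E →L[ℝ] E) := FiniteDimensional.proper ℝ _
  refine finite_of_isBounded_of_separated ?_ hδ ?_
  · refine (Metric.isBounded_closedBall (x := (0 : (E →L[ℝ] E) × E)) (r := max 1 R)).subset ?_
    rintro _ ⟨g, ⟨-, hg⟩, rfl⟩
    rw [mem_closedBall_zero_iff, Prod.norm_def]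
    exact max_le_max (norm_linPart_le g) hg
  · rintro _ ⟨g, ⟨hg, -⟩, rfl⟩ _ ⟨h, ⟨hh, -⟩, rfl⟩ hgh
    rw [Prod.dist_eq, max_lt_iff, dist_eq_norm, dist_eq_norm] at hgh
    -- Left multiplication by an isometry preserves both distances, so separation from the identity
    -- gives uniform separation.
    have key : h⁻¹ * g = 1 := by
      refine hdisc _ (Γ.mul_mem (Γ.inv_mem hh) hg) ?_ ?_
      · rw [linPart_mul, ← linPart_inv_mul_linPart h, ← mul_sub, norm_linPart_mul]
        exact hgh.1
      · have : (h⁻¹ * g) 0 = h⁻¹ (g 0) - h⁻¹ (h 0) := by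
          rw [inv_apply_self, sub_zero, mul_apply]
        rw [this, norm_apply_sub_apply]
        exact hgh.2
    rw [inv_mul_eq_one.1 key]

/-- A cobounded group of isometries contains elements with almost trivial linear part and
translating in almost any prescribed direction. -/
lemma exists_linPart_near_one {Γ : Subgroup (E ≃ᵢ E)} {R : ℝ}
    (hcob : ∀ x : E, ∃ g ∈ Γ, ‖g 0 - x‖ ≤ R) (u : E) {ε δ : ℝ} (hε : 0 < ε) (hδ : 0 < δ) :
    ∃ g ∈ Γ, ‖g.linPart - 1‖ < ε ∧ ∃ s : ℝ, 0 < s ∧ ‖g 0 - s • u‖ ≤ δ * s := by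
  choose β hβ hβu using fun k : ℕ => hcob ((k : ℝ) • u)
  have : ProperSpace (E →L[ℝ] E) := FiniteDimensional.proper ℝ _
  obtain ⟨a, -, φ, hφ, hlim⟩ := tendsto_subseq_of_bounded
    (Metric.isBounded_closedBall (x := (0 : E →L[ℝ] E)) (r := 1))
    (x := fun k => (β k).linPart)
    (fun k => mem_closedBall_zero_iff.2 (norm_linPart_le _))
  obtain ⟨i, hi⟩ := Metric.cauchySeq_iff'.1 hlim.cauchySeq ε hε
  -- With i fixed, the quotient β (φ j) (β (φ i))⁻¹ moves 0 to within R + ‖β (φ i) 0‖ of φ j • u;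
  -- for large j this error is at most δ times the scale s = φ j.
  obtain ⟨j, hj⟩ := exists_nat_gt (max (i : ℝ) ((R + ‖β (φ i) 0‖) / δ))
  have hij : i ≤ j := by exact_mod_cast ((le_max_left _ _).trans hj.le)
  have hj' : (R + ‖β (φ i) 0‖) / δ < φ j :=
    ((le_max_right _ _).trans_lt hj).trans_le (by exact_mod_cast hφ.id_le j)
  have hR : 0 ≤ R := (norm_nonneg _).trans (hβu 0)
  refine ⟨β (φ j) * (β (φ i))⁻¹, Γ.mul_mem (hβ _) (Γ.inv_mem (hβ _)), ?_, φ j, ?_, ?_⟩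
  · rw [linPart_mul, ← linPart_mul_linPart_inv (β (φ i)), ← sub_mul, norm_mul_linPart,
      ← dist_eq_norm]
    exact hi j hij
  · exact lt_of_le_of_lt (by positivity) hj'
  · have h1 : ‖(β (φ j) * (β (φ i))⁻¹) 0 - β (φ j) 0‖ = ‖β (φ i) 0‖ := by
      rw [mul_apply, norm_apply_sub_apply, sub_zero, norm_inv_apply_zero]
    have h2 := hβu (φ j)
    have h3 := norm_sub_le_norm_sub_add_norm_sub ((β (φ j) * (β (φ i))⁻¹) 0) (β (φ j) 0)
      ((φ j : ℝ) • u)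
    rw [div_lt_iff₀ hδ] at hj'
    linarith

lemma exists_norm_eq_one_and_norm_apply_eq {V W : Type*} [NormedAddCommGroup V]
    [NormedSpace ℝ V] [FiniteDimensional ℝ V] [Nontrivial V] [NormedAddCommGroup W]
    [NormedSpace ℝ W] (T : V →L[ℝ] W) :
    ∃ x : V, ‖x‖ = 1 ∧ ∀ y, ‖T y‖ ≤ ‖T x‖ * ‖y‖ := by
  have : ProperSpace V := FiniteDimensional.proper ℝ _
  obtain ⟨x, hx, hmax⟩ := (isCompact_sphere (0 : V) 1).exists_isMaxOn
    (NormedSpace.sphere_nonempty.2 zero_le_one) (f := fun x => ‖T x‖) (by fun_prop)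
  refine ⟨x, mem_sphere_zero_iff_norm.1 hx, fun y => ?_⟩
  rcases eq_or_ne y 0 with rfl | hy
  · simp
  have hy' : 0 < ‖y‖ := norm_pos_iff.2 hy
  have := hmax (a := ‖y‖⁻¹ • y) (by simp [norm_smul, hy'.ne'])
  simp only [Set.mem_ofPred_eq, map_smul, norm_smul, norm_inv, norm_norm] at this
  rwa [inv_mul_le_iff₀ hy', mul_comm] at this

/-- The space on which a linear isometry `A` displaces vectors maximally, and a bound for the
displacement on its orthogonal complement. -/
lemma exists_max_displacement_subspace (g : E ≃ᵢ E) (hg : g.linPart ≠ 1) :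
    ∃ (S : Submodule ℝ E) (μ : ℝ), (∃ u ∈ S, ‖u‖ = 1) ∧ 0 ≤ μ ∧ μ < ‖g.linPart - 1‖ ∧
      (∀ x ∈ S, (g.linPart - 1) x ∈ S) ∧ (∀ x ∈ Sᗮ, (g.linPart - 1) x ∈ Sᗮ) ∧
      (∀ x ∈ S, ‖(g.linPart - 1) x‖ = ‖g.linPart - 1‖ * ‖x‖) ∧
      ∀ x ∈ Sᗮ, ‖(g.linPart - 1) x‖ ≤ μ * ‖x‖ := by
  -- K is normal with adjoint K', so T = K'K is self-adjoint and commutes with both. The subspace S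
  -- below is the eigenspace of T for its top eigenvalue ‖K‖².
  set K := g.linPart - 1 with hK
  set K' := g⁻¹.linPart - 1 with hK'
  have hnorm : ∀ x, ‖K' x‖ = ‖K x‖ := by
    intro x
    have : K x = -g.linPart (K' x) := by
      simp [hK, hK', linPart_linPart_inv_apply]
    rw [this, norm_neg, norm_linPart_apply]
  have hadj : ∀ x y, inner ℝ (K x) y = inner ℝ x (K' y) := by
    intro x y
    have h := g.toRealLinearIsometryEquiv.inner_map_map x (g⁻¹.linPart y)
    have h' : inner ℝ (g.linPart x) (g.linPart (g⁻¹.linPart y)) =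
      inner ℝ x (g⁻¹.linPart y) := h
    rw [linPart_linPart_inv_apply] at h'
    simp [hK, hK', inner_sub_left, inner_sub_right, h']
  have hcomm : K * K' = K' * K := by
    simp [hK, hK', sub_mul, mul_sub, linPart_mul_linPart_inv, linPart_inv_mul_linPart]
    abel
  set m := ‖K‖ with hm
  set T := K' * K with hT
  have hadjT : ∀ x y, inner ℝ (T x) y = inner ℝ x (T y) := by
    intro x y
    have h1 : inner ℝ (T x) y = inner ℝ (K x) (K y) := by
      rw [real_inner_comm, hT, mul_apply_eq_comp, ← hadj, real_inner_comm]
    rw [h1, hadj]; rfl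
  have hTK : ∀ x, T (K x) = K (T x) := by
    intro x
    have : T * K = K * T := by rw [hT, ← mul_assoc, hcomm]
    exact congr($this x)
  have hTK' : ∀ x, T (K' x) = K' (T x) := by
    intro x
    have : T * K' = K' * T := by rw [hT, mul_assoc, hcomm]
    exact congr($this x)
  have hin : ∀ x, inner ℝ (T x) x = ‖K x‖ ^ 2 := by
    intro x
    rw [hadjT, hT, mul_apply_eq_comp, ← hadj, real_inner_self_eq_norm_sq]
  let S : Submodule ℝ E := LinearMap.ker ((T - (m ^ 2) • (1 : E →L[ℝ] E) : E →L[ℝ] E) : E →ₗ[ℝ] E)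
  have hS : ∀ x, x ∈ S ↔ T x = (m ^ 2) • x := by
    intro x
    simp [S, sub_eq_zero]
  -- Expanding ‖Tx - m²x‖² with ⟨Tx, x⟩ = ‖Kx‖² and ‖Tx‖ ≤ m²‖x‖ gives a value that is at most 0.
  have hS' : ∀ x, ‖K x‖ = m * ‖x‖ → x ∈ S := by
    intro x hx
    rw [hS, ← sub_eq_zero, ← norm_eq_zero, ← sq_eq_zero_iff, norm_sub_sq_real,
      inner_smul_right, hin, norm_smul, hx]
    have h1 : ‖T x‖ ≤ m * (m * ‖x‖) := by
      rw [← hx, hT, mul_apply_eq_comp, hnorm]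
      exact K.le_opNorm _
    have h2 : ‖T x‖ ^ 2 ≤ (m * (m * ‖x‖)) ^ 2 := pow_le_pow_left₀ (norm_nonneg _) h1 2
    have h3 := sq_nonneg ‖T x - (m ^ 2) • x‖
    rw [norm_sub_sq_real, inner_smul_right, hin, norm_smul, hx] at h3
    have h4 : ‖m ^ 2‖ = m ^ 2 := by simp
    rw [h4] at h3 ⊢
    nlinarith
  have hKS : ∀ x ∈ S, ‖K x‖ = m * ‖x‖ := by
    intro x hx
    have h := hin x
    rw [(hS x).1 hx, inner_smul_left, real_inner_self_eq_norm_sq] at h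
    have : ‖K x‖ ^ 2 = (m * ‖x‖) ^ 2 := by rw [← h]; simp; ring
    exact (sq_eq_sq₀ (norm_nonneg _) (by positivity)).1 this
  have hK0 : K ≠ 0 := sub_ne_zero.2 hg
  have hmpos : 0 < m := norm_pos_iff.2 hK0
  have hnt : Nontrivial E := by
    by_contra h
    rw [not_nontrivial_iff_subsingleton] at h
    exact hK0 (Subsingleton.elim _ _)
  have hKmem : ∀ x ∈ S, K x ∈ S := fun x hx => by
    rw [hS] at hx ⊢
    rw [hTK, hx, map_smul]
  have hK'mem : ∀ x ∈ S, K' x ∈ S := fun x hx => by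
    rw [hS] at hx ⊢
    rw [hTK', hx, map_smul]
  have hKperp : ∀ x ∈ Sᗮ, K x ∈ Sᗮ := fun x hx => by
    rw [Submodule.mem_orthogonal'] at hx ⊢
    intro y hy
    rw [hadj]
    exact hx _ (hK'mem y hy)
  have hbound : ∃ μ : ℝ, 0 ≤ μ ∧ μ < m ∧ ∀ x ∈ Sᗮ, ‖K x‖ ≤ μ * ‖x‖ := by
    rcases subsingleton_or_nontrivial Sᗮ with h | h
    · refine ⟨0, le_rfl, hmpos, fun x hx => ?_⟩
      have : x = 0 := congrArg Subtype.val (Subsingleton.elim (⟨x, hx⟩ : Sᗮ) 0)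
      simp [this]
    · obtain ⟨x, hx, hmax⟩ := exists_norm_eq_one_and_norm_apply_eq (K ∘L Sᗮ.subtypeL)
      replace hx : ‖(x : E)‖ = 1 := hx
      refine ⟨‖K x‖, norm_nonneg _, lt_of_le_of_ne ?_ ?_, fun y hy => hmax ⟨y, hy⟩⟩
      · have := K.le_opNorm x
        rwa [hx, mul_one] at this
      -- A maximum on the unit sphere of Sᗮ equal to m would be attained at a vector that also lies
      -- in S.
      · intro heq
        have hxS : (x : E) ∈ S := hS' x (by rw [heq, hx, mul_one])
        have h0 : inner ℝ (x : E) (x : E) = 0 :=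
          Submodule.inner_right_of_mem_orthogonal hxS x.2
        rw [inner_self_eq_zero] at h0
        rw [h0, norm_zero] at hx
        exact zero_ne_one hx
  obtain ⟨μ, hμ0, hμm, hμ⟩ := hbound
  obtain ⟨u, hu, hmax⟩ := exists_norm_eq_one_and_norm_apply_eq K
  refine ⟨S, μ, ⟨u, hS' u ?_, hu⟩, hμ0, hμm, hKmem, hKperp, hKS, hμ⟩
  have h1 := K.le_opNorm u
  have h2 : m ≤ ‖K u‖ := K.opNorm_le_bound (norm_nonneg _) hmax
  rw [hu, mul_one] at h1 ⊢
  exact le_antisymm h1 h2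

end Bieberbach

/-! ### Translation lattice and commutator estimates -/

section Isometries

variable {E : Type*} [NormedAddCommGroup E]

/-- The lattice of translations contained in a group of isometries. -/
def translationLattice (Γ : Subgroup (E ≃ᵢ E)) : Submodule ℤ E :=
  AddSubgroup.toIntSubmodule
    { carrier := {t | ∃ g ∈ Γ, ∀ x, g x = x + t}
      zero_mem' := ⟨1, Γ.one_mem, fun x => by simp⟩
      add_mem' := by
        rintro s t ⟨g, hg, hgs⟩ ⟨h, hh, hht⟩
        refine ⟨g * h, Γ.mul_mem hg hh, fun x => ?_⟩
        rw [mul_apply, hht, hgs, add_assoc, add_comm t]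
      neg_mem' := by
        rintro t ⟨g, hg, hgt⟩
        refine ⟨g⁻¹, Γ.inv_mem hg, fun x => ?_⟩
        rw [← g.injective.eq_iff, apply_inv_self, hgt, neg_add_cancel_right] }

lemma mem_translationLattice {Γ : Subgroup (E ≃ᵢ E)} {t : E} :
    t ∈ translationLattice Γ ↔ ∃ g ∈ Γ, ∀ x, g x = x + t := Iff.rfl

lemma discreteTopology_translationLattice {Γ : Subgroup (E ≃ᵢ E)}
    (hfin : ∀ R : ℝ, {g : E ≃ᵢ E | g ∈ Γ ∧ ‖g 0‖ ≤ R}.Finite) :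
    DiscreteTopology (translationLattice Γ) := by
  have hF : {t : translationLattice Γ | ‖(t : E)‖ ≤ 1}.Finite := by
    refine Set.Finite.of_finite_image (f := ((↑) : translationLattice Γ → E)) ?_
      Subtype.val_injective.injOn
    refine ((hfin 1).image fun g => g 0).subset ?_
    rintro _ ⟨⟨t, g, hg, hgt⟩, ht, rfl⟩
    have hg0 : g 0 = t := by rw [hgt, zero_add]
    exact ⟨g, ⟨hg, hg0 ▸ ht⟩, hg0⟩
  refine discreteTopology_of_isOpen_singleton_zero ?_
  have : ({0} : Set (translationLattice Γ)) = Metric.ball 0 1 ∩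
      ({t : translationLattice Γ | ‖(t : E)‖ ≤ 1} \ {0})ᶜ := by
    ext t
    by_cases ht : t = 0
    · simp [ht]
    · simp only [Set.mem_singleton_iff, ht, Set.mem_inter_iff, mem_ball_zero_iff, Set.mem_compl_iff,
        Set.mem_sdiff, not_false_eq_true, and_true, false_iff, not_and, not_not]
      exact fun h => h.le
  rw [this]
  exact Metric.isOpen_ball.inter (hF.subset Set.sdiff_subset).isClosed.isOpen_compl

variable [NormedSpace ℝ E]

/-- Isolates the main term: when the linear parts of h and of the commutator are close to 1, the
commutator translates nearly by (A - 1) h(0), with A the linear part of g. -/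
lemma commutator_apply_zero (g h : E ≃ᵢ E) :
    (g * h * g⁻¹ * h⁻¹) 0 = (g.linPart - 1) (h 0) +
      ((1 - (g * h * g⁻¹ * h⁻¹).linPart) (h 0) +
        g.linPart ((1 - h.linPart) (g⁻¹.linPart (g 0)))) := by
  simp only [mul_apply, linPart_mul, mul_apply_eq_comp, sub_apply,
    one_apply_eq_self, map_sub, linPart_linPart_inv_apply]
  rw [apply_eq_linPart_add g, apply_eq_linPart_add h, apply_eq_linPart_add g⁻¹,
    inv_apply_zero h, inv_apply_zero g]
  simp only [map_add, map_neg]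
  abel

/-- Multiplying by isometries keeps the norm, so it suffices to bound AB - BA = (A - 1)(B - 1) - (B
- 1)(A - 1). -/
lemma norm_linPart_commutator_sub_one_le (g h : E ≃ᵢ E) :
    ‖(g * h * g⁻¹ * h⁻¹).linPart - 1‖ ≤ 2 * ‖g.linPart - 1‖ * ‖h.linPart - 1‖ := by
  have h1 : (g * h * g⁻¹ * h⁻¹).linPart - 1 =
      ((g * h).linPart - (h * g).linPart) * g⁻¹.linPart * h⁻¹.linPart := by
    have : (h * g).linPart * g⁻¹.linPart * h⁻¹.linPart = 1 := by
      rw [← linPart_mul, ← linPart_mul]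
      simp
    rw [sub_mul, sub_mul, this, ← linPart_mul, ← linPart_mul]
  have h2 : (g * h).linPart - (h * g).linPart =
      (g.linPart - 1) * (h.linPart - 1) - (h.linPart - 1) * (g.linPart - 1) := by
    simp only [linPart_mul]
    noncomm_ring
  rw [h1, norm_mul_linPart, norm_mul_linPart, h2]
  refine (norm_sub_le _ _).trans ?_
  have h3 := norm_mul_le (g.linPart - 1) (h.linPart - 1)
  have h4 := norm_mul_le (h.linPart - 1) (g.linPart - 1)
  linarith

lemma apply_zero_mem_translationLattice {Γ : Subgroup (E ≃ᵢ E)} {g : E ≃ᵢ E} (hg : g ∈ Γ)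
    (h : g.linPart = 1) : g 0 ∈ translationLattice Γ :=
  ⟨g, hg, linPart_eq_one_iff.1 h⟩

/-- Conjugating the translation by t with g gives the translation by the linear part of g applied to
t. -/
lemma linPart_mem_translationLattice {Γ : Subgroup (E ≃ᵢ E)} {g : E ≃ᵢ E} (hg : g ∈ Γ) {t : E}
    (ht : t ∈ translationLattice Γ) : g.linPart t ∈ translationLattice Γ := by
  obtain ⟨h, hh, hht⟩ := ht
  refine ⟨g * h * g⁻¹, Γ.mul_mem (Γ.mul_mem hg hh) (Γ.inv_mem hg), fun x => ?_⟩
  rw [mul_apply, mul_apply, hht, apply_add, apply_inv_self]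

end Isometries

/-! ### Small rotations are trivial: lattice and holonomy -/

section Bieberbach

variable {E : Type*} [NormedAddCommGroup E] [InnerProductSpace ℝ E] [FiniteDimensional ℝ E]

/-- In a discrete cobounded group of isometries, every element with linear part close to the
identity is a translation. -/
lemma linPart_eq_one_of_norm_sub_one_le {Γ : Subgroup (E ≃ᵢ E)} {R : ℝ}
    (hfin : ∀ R : ℝ, {g : E ≃ᵢ E | g ∈ Γ ∧ ‖g 0‖ ≤ R}.Finite)
    (hcob : ∀ x : E, ∃ g ∈ Γ, ‖g 0 - x‖ ≤ R) {g : E ≃ᵢ E} (hg : g ∈ Γ)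
    (hg2 : ‖g.linPart - 1‖ ≤ 1 / 2) : g.linPart = 1 := by
  by_contra hne
  -- The shortest counterexample; its minimality is used to bound ‖a 0‖ by ‖b 0‖ whenever b is not a
  -- translation.
  obtain ⟨a, ha, ⟨hane, ha2⟩, hamin⟩ := exists_min_norm_apply_zero hfin
    (fun g => g.linPart ≠ 1 ∧ ‖g.linPart - 1‖ ≤ 1 / 2) ⟨g, hg, hne, hg2⟩
  obtain ⟨S, μ, ⟨u, huS, hu⟩, hμ0, hμm, hKS, hKperp, hmS, hμ⟩ :=
    exists_max_displacement_subspace a hane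
  set m := ‖a.linPart - 1‖ with hm
  set p := S.starProjection
  set q := Sᗮ.starProjection
  have hpq : ∀ x, p x + q x = x := fun x => S.starProjection_add_starProjection_orthogonal x
  have hpS : ∀ x, p x ∈ S := fun x => S.starProjection_apply_mem x
  have hqS : ∀ x, q x ∈ Sᗮ := fun x => Sᗮ.starProjection_apply_mem x
  have hpn : ∀ x, ‖p x‖ ≤ ‖x‖ := fun x => S.norm_starProjection_apply_le x
  have hqn : ∀ x, ‖q x‖ ≤ ‖x‖ := fun x => Sᗮ.norm_starProjection_apply_le x
  have hp1 : ∀ x ∈ S, p x = x := fun x hx => S.starProjection_eq_self_iff.2 hx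
  have hq0 : ∀ x ∈ S, q x = 0 := fun x hx => by
    have := hpq x
    rwa [hp1 x hx, add_eq_left] at this
  have hq1 : ∀ x ∈ Sᗮ, q x = x := fun x hx => Sᗮ.starProjection_eq_self_iff.2 hx
  have hp0 : ∀ x ∈ Sᗮ, p x = 0 := fun x hx => by
    have := hpq x
    rwa [hq1 x hx, add_eq_right] at this
  -- The shortest element translating more along S than along Sᗮ with linear part within (m - μ)/8
  -- of 1. This tolerance makes the commutator's remainder r smaller than half the gap between the
  -- factors m on S and μ on Sᗮ, so the commutator again translates mainly along S.
  obtain ⟨b, hb, ⟨hbq, hbm⟩, hbmin⟩ := exists_min_norm_apply_zero hfin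
    (fun g => ‖q (g 0)‖ < ‖p (g 0)‖ ∧ ‖g.linPart - 1‖ ≤ (m - μ) / 8) (by
      obtain ⟨b, hb, hb1, s, hs, hbs⟩ := exists_linPart_near_one hcob u
        (ε := (m - μ) / 8) (δ := 1 / 4) (by linarith) (by norm_num)
      refine ⟨b, hb, ?_, hb1.le⟩
      have h1 : q (b 0) = q (b 0 - s • u) := by
        rw [map_sub, map_smul, hq0 u huS, smul_zero, sub_zero]
      have h2 : s • u = p (b 0) - p (b 0 - s • u) := by
        rw [map_sub, map_smul, hp1 u huS, sub_sub_cancel]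
      have h3 : s ≤ ‖p (b 0)‖ + ‖p (b 0 - s • u)‖ := by
        refine le_trans (le_of_eq ?_) (norm_sub_le _ _)
        rw [← h2, norm_smul, hu, mul_one, Real.norm_of_nonneg hs.le]
      have h4 := hpn (b 0 - s • u)
      have h5 := hqn (b 0 - s • u)
      rw [h1]
      linarith)
  set c := a * b * a⁻¹ * b⁻¹ with hc
  have hcΓ : c ∈ Γ := Γ.mul_mem (Γ.mul_mem (Γ.mul_mem ha hb) (Γ.inv_mem ha)) (Γ.inv_mem hb)
  have hcm : ‖c.linPart - 1‖ ≤ ‖b.linPart - 1‖ := by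
    have := norm_linPart_commutator_sub_one_le a b
    nlinarith [norm_nonneg (b.linPart - 1)]
  set r : E := (1 - c.linPart) (b 0) + a.linPart ((1 - b.linPart) (a⁻¹.linPart (a 0))) with hr
  have hc0 : c 0 = (a.linPart - 1) (b 0) + r := commutator_apply_zero a b
  -- If b is a translation, minimality of a says nothing, but then both sides vanish.
  have hba : ‖b.linPart - 1‖ * ‖a 0‖ ≤ ‖b.linPart - 1‖ * ‖b 0‖ := by
    by_cases hb1 : b.linPart = 1
    · simp [hb1]
    · refine mul_le_mul_of_nonneg_left (hamin b hb ⟨hb1, ?_⟩) (norm_nonneg _)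
      linarith
  have hrn : ‖r‖ ≤ (m - μ) / 4 * ‖b 0‖ := by
    have h1 : ‖(1 - c.linPart) (b 0)‖ ≤ ‖c.linPart - 1‖ * ‖b 0‖ := by
      rw [← norm_sub_rev]
      exact ContinuousLinearMap.le_opNorm _ _
    have h2 : ‖a.linPart ((1 - b.linPart) (a⁻¹.linPart (a 0)))‖ ≤ ‖b.linPart - 1‖ * ‖a 0‖ := by
      rw [norm_linPart_apply, ← norm_sub_rev, ← norm_linPart_apply a⁻¹ (a 0)]
      exact ContinuousLinearMap.le_opNorm _ _
    have h3 := norm_add_le ((1 - c.linPart) (b 0))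
      (a.linPart ((1 - b.linPart) (a⁻¹.linPart (a 0))))
    have h4 := mul_le_mul_of_nonneg_right hcm (norm_nonneg (b 0))
    have h5 := mul_le_mul_of_nonneg_right hbm (norm_nonneg (b 0))
    linarith
  have hb0 : ‖b 0‖ < 2 * ‖p (b 0)‖ := by
    have := norm_add_le (p (b 0)) (q (b 0))
    rw [hpq] at this
    linarith
  have hrp : ‖r‖ < (m - μ) / 2 * ‖p (b 0)‖ := by nlinarith
  have hKb : (a.linPart - 1) (b 0) = (a.linPart - 1) (p (b 0)) + (a.linPart - 1) (q (b 0)) := by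
    rw [← map_add, hpq]
  have hpc : p (c 0) = (a.linPart - 1) (p (b 0)) + p r := by
    rw [hc0, hKb, map_add, map_add, hp1 _ (hKS _ (hpS _)), hp0 _ (hKperp _ (hqS _)), add_zero]
  have hqc : q (c 0) = (a.linPart - 1) (q (b 0)) + q r := by
    rw [hc0, hKb, map_add, map_add, hq0 _ (hKS _ (hpS _)), hq1 _ (hKperp _ (hqS _)), zero_add]
  have hcq : ‖q (c 0)‖ < ‖p (c 0)‖ := by
    have h1 := norm_add_le ((a.linPart - 1) (q (b 0))) (q r)
    have h2 := norm_sub_le ((a.linPart - 1) (p (b 0)) + p r) (p r)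
    rw [← hqc] at h1
    rw [add_sub_cancel_right, ← hpc, hmS _ (hpS _)] at h2
    have h3 := hμ _ (hqS (b 0))
    have h4 := mul_le_mul_of_nonneg_left hbq.le hμ0
    linarith [hpn r, hqn r]
  have hle := hbmin c hcΓ ⟨hcq, hcm.trans hbm⟩
  have h1 : ‖c 0‖ ≤ m * ‖b 0‖ + ‖r‖ := by
    rw [hc0]
    exact (norm_add_le _ _).trans (by gcongr; exact ContinuousLinearMap.le_opNorm _ _)
  have hb0pos : 0 < ‖b 0‖ := by
    have := hpn (b 0)
    linarith [norm_nonneg (q (b 0))]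
  -- Since m ≤ 1/2 and ‖r‖ ≤ (m - μ)/4 · ‖b 0‖, the commutator satisfies ‖c 0‖ ≤ 5/8 · ‖b 0‖,
  -- against the minimality of b.
  nlinarith

/-- The translations in a discrete cobounded group of isometries span the space. -/
lemma span_translationLattice {Γ : Subgroup (E ≃ᵢ E)} {R : ℝ}
    (hfin : ∀ R : ℝ, {g : E ≃ᵢ E | g ∈ Γ ∧ ‖g 0‖ ≤ R}.Finite)
    (hcob : ∀ x : E, ∃ g ∈ Γ, ‖g 0 - x‖ ≤ R) :
    Submodule.span ℝ (translationLattice Γ : Set E) = ⊤ := by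
  rw [← Submodule.orthogonal_eq_bot_iff, Submodule.eq_bot_iff]
  intro u hu
  by_contra hne
  have hpos : 0 < ‖u‖ := norm_pos_iff.2 hne
  obtain ⟨g, hg, hg1, s, hs, hgs⟩ := exists_linPart_near_one hcob u
    (ε := 1 / 2) (δ := ‖u‖ / 2) (by norm_num) (by positivity)
  -- This g is a translation nearly parallel to u, whereas u is orthogonal to all translations.
  have hlin := linPart_eq_one_of_norm_sub_one_le hfin hcob hg hg1.le
  have h0 : inner ℝ (g 0) u = 0 := Submodule.inner_right_of_mem_orthogonal
    (Submodule.subset_span (apply_zero_mem_translationLattice hg hlin)) hu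
  have h1 := abs_real_inner_le_norm (g 0 - s • u) u
  rw [inner_sub_left, h0, inner_smul_left, real_inner_self_eq_norm_sq, zero_sub, abs_neg] at h1
  have h2 : s * ‖u‖ ^ 2 ≤ ‖g 0 - s • u‖ * ‖u‖ := (le_abs_self _).trans h1
  have h3 := mul_le_mul_of_nonneg_right hgs hpos.le
  have h4 : 0 < s * ‖u‖ ^ 2 := by positivity
  nlinarith

/-- The holonomy group of a discrete cobounded group of isometries is finite. -/
lemma finite_image_linPart {Γ : Subgroup (E ≃ᵢ E)} {R : ℝ}
    (hfin : ∀ R : ℝ, {g : E ≃ᵢ E | g ∈ Γ ∧ ‖g 0‖ ≤ R}.Finite)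
    (hcob : ∀ x : E, ∃ g ∈ Γ, ‖g 0 - x‖ ≤ R) :
    (linPart '' (Γ : Set (E ≃ᵢ E))).Finite := by
  have : ProperSpace (E →L[ℝ] E) := FiniteDimensional.proper ℝ _
  refine finite_of_isBounded_of_separated (δ := 1 / 2) ?_ (by norm_num) ?_
  · refine (Metric.isBounded_closedBall (x := (0 : E →L[ℝ] E)) (r := 1)).subset ?_
    rintro _ ⟨g, -, rfl⟩
    exact mem_closedBall_zero_iff.2 (norm_linPart_le g)
  · rintro _ ⟨g, hg, rfl⟩ _ ⟨h, hh, rfl⟩ hgh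
    have h1 : (g * h⁻¹).linPart = 1 := by
      refine linPart_eq_one_of_norm_sub_one_le hfin hcob (Γ.mul_mem hg (Γ.inv_mem hh)) ?_
      rw [linPart_mul, ← linPart_mul_linPart_inv h, ← sub_mul, norm_mul_linPart, ← dist_eq_norm]
      exact hgh.le
    calc g.linPart = (g * h⁻¹ * h).linPart := by rw [inv_mul_cancel_right]
      _ = h.linPart := by rw [linPart_mul, h1, one_mul]

end Bieberbach

/-! ### Closed flat manifolds and their fundamental groups -/

section FlatManifold

variable {n : ℕ} {Γ : Subgroup (EucIsom n)}

instance eucIsom_continuousConstSMul (Γ : Subgroup (EucIsom n)) :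
    ContinuousConstSMul Γ (Euc n) :=
  ⟨fun g => (g : EucIsom n).continuous⟩

open Topology in
/-- The identity is isolated in a discrete group of isometries. -/
lemma IsDiscrete.exists_pos_forall_eq_one (h : IsDiscrete (Γ : Set (EucIsom n))) :
    ∃ δ : ℝ, 0 < δ ∧ ∀ g ∈ Γ, ‖g.linPart - 1‖ < δ → ‖g 0‖ < δ → g = 1 := by
  obtain ⟨t, ht, hts⟩ := nhds_inter_eq_singleton_of_mem_discrete h Γ.one_mem
  rw [nhds_induced, Filter.mem_comap] at ht
  obtain ⟨u, hu, hut⟩ := ht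
  obtain ⟨⟨K, ε⟩, ⟨hK, hε⟩, hKu⟩ := (nhds_basis_uniformity'
    Metric.uniformity_basis_dist.compactConvergenceUniformity).mem_iff.1 hu
  obtain ⟨r, hr0, hr⟩ := hK.isBounded.exists_pos_norm_le
  refine ⟨ε / (r + 1), by positivity, fun g hg h1 h2 => ?_⟩
  have hgt : g ∈ t ∩ Γ := by
    refine ⟨hut (hKu fun x hx => ?_), hg⟩
    change dist x (g x) < ε
    have h3 : g x - x = (g.linPart - 1) x + g 0 := by
      rw [apply_eq_linPart_add g x, sub_apply, one_apply_eq_self]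
      abel
    rw [dist_comm, dist_eq_norm, h3]
    calc ‖(g.linPart - 1) x + g 0‖ ≤ ‖g.linPart - 1‖ * r + ‖g 0‖ :=
          (norm_add_le _ _).trans (by
            gcongr
            exact ContinuousLinearMap.le_opNorm_of_le _ (hr x hx))
      _ < ε / (r + 1) * r + ε / (r + 1) := by gcongr
      _ = ε := by field_simp
  rw [hts] at hgt
  exact hgt

lemma IsBieberbachGroup.finite_norm_le (h : IsBieberbachGroup Γ) (R : ℝ) :
    {g : EucIsom n | g ∈ Γ ∧ ‖g 0‖ ≤ R}.Finite := by
  obtain ⟨δ, hδ, hdisc⟩ := h.discrete.exists_pos_forall_eq_one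
  exact finite_norm_apply_zero_le Γ hδ hdisc R

/-- The images of the balls about 0 form an increasing open cover of the compact orbit space, so a
single ball meets every orbit. -/
lemma exists_norm_apply_zero_sub_le (h : CompactSpace (OrbitSpace Γ)) :
    ∃ R : ℝ, ∀ x : Euc n, ∃ g ∈ Γ, ‖g 0 - x‖ ≤ R := by
  let π : Euc n → OrbitSpace Γ := Quotient.mk _
  have hopen : IsOpenMap π := isOpenMap_quotient_mk'_mul
  obtain ⟨t, ht⟩ := h.isCompact_univ.elim_directed_cover (fun k : ℕ => π '' Metric.ball 0 k)
    (fun k => hopen _ Metric.isOpen_ball) (fun y _ => by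
      obtain ⟨x, rfl⟩ := Quotient.exists_rep y
      obtain ⟨k, hk⟩ := exists_nat_gt ‖x‖
      exact Set.mem_iUnion.2 ⟨k, x, mem_ball_zero_iff.2 hk, rfl⟩)
    (Monotone.directed_le fun i j hij => Set.image_mono
      (Metric.ball_subset_ball (by exact_mod_cast hij)))
  refine ⟨t, fun x => ?_⟩
  obtain ⟨y, hy, hyx⟩ := ht (Set.mem_univ (π x))
  obtain ⟨g, hg⟩ := Quotient.exact hyx
  refine ⟨(g : EucIsom n)⁻¹, Γ.inv_mem g.2, ?_⟩
  have hgx : (g : EucIsom n) x = y := hg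
  rw [← inv_apply_self (g : EucIsom n) x, norm_apply_sub_apply, hgx, zero_sub, norm_neg]
  exact (mem_ball_zero_iff.1 hy).le

lemma IsBieberbachGroup.properlyDiscontinuousSMul (h : IsBieberbachGroup Γ) :
    ProperlyDiscontinuousSMul Γ (Euc n) where
  finite_disjoint_inter_image := by
    intro K L hK hL
    obtain ⟨r, hr⟩ := hK.isBounded.exists_norm_le
    obtain ⟨s, hs⟩ := hL.isBounded.exists_norm_le
    refine Set.Finite.of_finite_image (f := ((↑) : Γ → EucIsom n)) ?_ Subtype.val_injective.injOn
    refine (h.finite_norm_le (r + s)).subset ?_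
    rintro _ ⟨g, ⟨_, ⟨x, hx, rfl⟩, hxL⟩, rfl⟩
    refine ⟨g.2, ?_⟩
    have h1 := norm_apply_sub_apply (g : EucIsom n) 0 x
    have h2 : ‖(g : EucIsom n) x‖ ≤ s := hs _ hxL
    have h3 := norm_sub_norm_le ((g : EucIsom n) 0) ((g : EucIsom n) x)
    rw [zero_sub, norm_neg] at h1
    linarith [hr x hx]

/-- Powers of an element fixing x move 0 by at most 2‖x‖, so there are finitely many of them;
torsion-freeness then makes the element trivial. -/
lemma IsBieberbachGroup.isCancelSMul (h : IsBieberbachGroup Γ) : IsCancelSMul Γ (Euc n) := by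
  rw [isCancelSMul_iff_eq_one_of_smul_eq]
  intro g x hgx
  have hpow : ∀ k : ℕ, (g ^ k) • x = x := fun k => by
    induction k with
    | zero => simp
    | succ k ih => rw [pow_succ, mul_smul, hgx, ih]
  have hfin : (Set.range fun k : ℕ => (g : EucIsom n) ^ k).Finite := by
    refine (h.finite_norm_le (2 * ‖x‖)).subset ?_
    rintro _ ⟨k, rfl⟩
    refine ⟨Γ.pow_mem g.2 k, ?_⟩
    have h1 := norm_apply_sub_apply ((g : EucIsom n) ^ k) 0 x
    have h2 : ((g : EucIsom n) ^ k) x = x := hpow k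
    have h3 := norm_sub_norm_le (((g : EucIsom n) ^ k) 0) x
    rw [h2, zero_sub, norm_neg] at h1
    linarith
  have hord : IsOfFinOrder (g : EucIsom n) := by
    by_contra hinf
    exact Set.infinite_range_of_injective (injective_pow_iff_not_isOfFinOrder.2 hinf) hfin
  exact Subtype.ext (h.torsionFree _ g.2 hord)

/-- The fundamental group of a closed flat manifold `Eⁿ / Γ` is isomorphic to `Γ`. -/
lemma IsBieberbachGroup.nonempty_fundamentalGroup_mulEquiv (h : IsBieberbachGroup Γ)
    (x : OrbitSpace Γ) : Nonempty (FundamentalGroup (OrbitSpace Γ) x ≃* Γ) := by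
  have := h.properlyDiscontinuousSMul
  have := h.isCancelSMul
  obtain ⟨y, hy⟩ := Quotient.exists_rep x
  -- The covering identifies the fundamental group with the opposite of Γ; inversion turns this into
  -- Γ.
  exact ⟨((isQuotientCoveringMap_quotientMk_of_properlyDiscontinuousSMul
    (G := Γ) (E := Euc n)).fundamentalGroupEquiv ⟨y, hy⟩).trans (MulEquiv.inv' Γ).symm⟩

end FlatManifold

/-! ### Lorentzian forms `D ⊕ H₂` and stabilizers of light-like vectors -/

section Shear

variable {n : ℕ} {R : Type*} [CommRing R]

/-- The block matrix `(P, 0, u; w, 1, s; 0, 0, 1)`. -/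
def shearMatrix (P : Matrix (Fin n) (Fin n) R) (u w : Fin n → R) (s : R) :
    Matrix (Fin n ⊕ Fin 2) (Fin n ⊕ Fin 2) R :=
  Matrix.fromBlocks P (Matrix.of fun i => ![0, u i]) (Matrix.of ![w, 0]) !![1, s; 0, 1]

lemma shearMatrix_one : shearMatrix (1 : Matrix (Fin n) (Fin n) R) 0 0 0 = 1 := by
  rw [shearMatrix, ← Matrix.fromBlocks_one]
  congr 1
  · ext i j; fin_cases j <;> simp
  · ext i j; fin_cases i <;> simp
  · ext i j; fin_cases i <;> fin_cases j <;> simp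

lemma shearMatrix_mul (P P' : Matrix (Fin n) (Fin n) R) (u w u' w' : Fin n → R) (s s' : R) :
    shearMatrix P u w s * shearMatrix P' u' w' s' =
      shearMatrix (P * P') (u + P *ᵥ u') (w ᵥ* P' + w') (s + w ⬝ᵥ u' + s') := by
  rw [shearMatrix, shearMatrix, shearMatrix, Matrix.fromBlocks_multiply]
  congr 1
  · ext i j
    simp [Matrix.mul_apply]
  · ext i j
    fin_cases j <;> simp [Matrix.mul_apply, Matrix.mulVec, dotProduct, add_comm]
  · ext i j
    fin_cases i <;> simp [Matrix.vecMul, dotProduct]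
  · ext i j
    fin_cases i <;> fin_cases j <;> simp [Matrix.vecMul, dotProduct]
    ring

lemma shearMatrix_map {S : Type*} [CommRing S] (f : R →+* S) (P : Matrix (Fin n) (Fin n) R)
    (u w : Fin n → R) (s : R) :
    (shearMatrix P u w s).map f = shearMatrix (P.map f) (f ∘ u) (f ∘ w) (f s) := by
  rw [shearMatrix, shearMatrix, Matrix.fromBlocks_map]
  congr 1
  · ext i j; fin_cases j <;> simp
  · ext i j; fin_cases i <;> simp
  · ext i j; fin_cases i <;> fin_cases j <;> simp

/-- The hypotheses are the Gram conditions on the columns: `hu` makes the last column orthogonal to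
the first n, and `hs` makes it isotropic. -/
lemma shearMatrix_transpose_mul_mul {P D : Matrix (Fin n) (Fin n) R} {u w : Fin n → R} {s : R}
    (hD : D.IsSymm) (hP : Pᵀ * D * P = D) (hu : Pᵀ *ᵥ (D *ᵥ u) = -w)
    (hs : u ⬝ᵥ (D *ᵥ u) + 2 * s = 0) :
    (shearMatrix P u w s)ᵀ * Matrix.fromBlocks D 0 0 !![0, 1; 1, 0] * shearMatrix P u w s =
      Matrix.fromBlocks D 0 0 !![0, 1; 1, 0] := by
  have hu' : Pᵀ * D * Matrix.of (fun i => ![0, u i]) =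
      Matrix.of fun i => ![0, -w i] := by
    ext i j
    have := congrFun hu i
    rw [Matrix.mulVec_mulVec] at this
    fin_cases j
    · simp [Matrix.mul_apply]
    · simpa [Matrix.mulVec, dotProduct, Matrix.mul_apply (M := Pᵀ * D)] using this
  have huT : (Matrix.of (fun i => ![0, u i]))ᵀ * D * P = (Matrix.of fun i => ![0, -w i])ᵀ := by
    rw [← hu', Matrix.transpose_mul, Matrix.transpose_mul, Matrix.transpose_transpose, hD.eq,
      Matrix.mul_assoc]
  have huu : (Matrix.of (fun i => ![0, u i]))ᵀ * D * Matrix.of (fun i => ![0, u i]) =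
      !![0, 0; 0, -2 * s] := by
    have h : u ⬝ᵥ (D *ᵥ u) = -2 * s := by linear_combination hs
    rw [Matrix.dotProduct_mulVec] at h
    ext i j
    fin_cases i <;> fin_cases j
    · simp [Matrix.mul_apply]
    · simp [Matrix.mul_apply]
    · simp [Matrix.mul_apply]
    · simpa [Matrix.mul_apply, Matrix.vecMul, dotProduct] using h
  rw [shearMatrix, Matrix.fromBlocks_transpose, Matrix.fromBlocks_multiply,
    Matrix.fromBlocks_multiply]
  simp only [Matrix.mul_zero, add_zero, zero_add]
  rw [hP, hu', huT, huu]
  congr 1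
  · ext i j
    simp [Matrix.mul_apply]
  · ext i j
    fin_cases j <;> simp [Matrix.mul_apply]
  · ext i j
    fin_cases i <;> simp [Matrix.mul_apply]
  · ext i j
    fin_cases i <;> fin_cases j <;> simp [Matrix.mul_apply, Fin.sum_univ_two]
    ring

lemma shearMatrix_mulVec_inr_one (P : Matrix (Fin n) (Fin n) R) (u w : Fin n → R) (s : R)
    (x : Fin n ⊕ Fin 2 → R) : (shearMatrix P u w s *ᵥ x) (Sum.inr 1) = x (Sum.inr 1) := by
  simp [shearMatrix, Matrix.mulVec, dotProduct]

end Shear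

/-! ### Sheets of the hyperboloid -/

section Hyperboloid

variable {n : ℕ} {D : Matrix (Fin n) (Fin n) ℝ}

lemma dotProduct_fromBlocks_mulVec {R : Type*} [CommRing R] (D : Matrix (Fin n) (Fin n) R)
    (x : Fin n ⊕ Fin 2 → R) :
    x ⬝ᵥ (Matrix.fromBlocks D 0 0 !![0, 1; 1, 0] *ᵥ x) =
      (x ∘ Sum.inl) ⬝ᵥ (D *ᵥ (x ∘ Sum.inl)) + 2 * (x (Sum.inr 0) * x (Sum.inr 1)) := by
  simp [dotProduct, Matrix.mulVec, Fin.sum_univ_two]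
  ring

/-- The sheets of the hyperboloid of `D ⊕ H₂`, with `D` positive definite, are cut out by the sign
of the last coordinate. -/
lemma mem_connectedComponentIn_hyperboloid (hD : D.PosDef) {x y : Fin n ⊕ Fin 2 → ℝ}
    (hx : x ∈ hyperboloid (Matrix.fromBlocks D 0 0 !![0, 1; 1, 0]))
    (hy : y ∈ hyperboloid (Matrix.fromBlocks D 0 0 !![0, 1; 1, 0]))
    (hxy : y (Sum.inr 1) = x (Sum.inr 1)) :
    y ∈ connectedComponentIn (hyperboloid (Matrix.fromBlocks D 0 0 !![0, 1; 1, 0])) x := by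
  have hmem : ∀ z : Fin n ⊕ Fin 2 → ℝ, z ∈ hyperboloid (Matrix.fromBlocks D 0 0 !![0, 1; 1, 0]) ↔
      (z ∘ Sum.inl) ⬝ᵥ (D *ᵥ (z ∘ Sum.inl)) + 2 * (z (Sum.inr 0) * z (Sum.inr 1)) = -1 := by
    intro z
    rw [← dotProduct_fromBlocks_mulVec]
    rfl
  have hx0 : x (Sum.inr 1) ≠ 0 := by
    intro h0
    have h1 := (hmem x).1 hx
    have h2 : 0 ≤ (x ∘ Sum.inl) ⬝ᵥ (D *ᵥ (x ∘ Sum.inl)) :=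
      hD.posSemidef.dotProduct_mulVec_nonneg (x ∘ Sum.inl)
    rw [h0] at h1
    linarith
  set c := x (Sum.inr 1) with hc
  -- Where the last coordinate equals c ≠ 0, the equation is linear in the other null coordinate;
  -- the slice is therefore a graph over ℝⁿ, hence connected.
  let f : (Fin n → ℝ) → (Fin n ⊕ Fin 2 → ℝ) :=
    fun v => Sum.elim v ![(-1 - v ⬝ᵥ (D *ᵥ v)) / (2 * c), c]
  have hf : Continuous f := by
    refine continuous_pi fun i => ?_
    rcases i with i | i
    · exact continuous_apply i
    · fin_cases i
      · change Continuous fun v : Fin n → ℝ => (-1 - v ⬝ᵥ (D *ᵥ v)) / (2 * c)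
        fun_prop
      · exact continuous_const
  have hrange : Set.range f ⊆ hyperboloid (Matrix.fromBlocks D 0 0 !![0, 1; 1, 0]) := by
    rintro _ ⟨v, rfl⟩
    rw [hmem]
    have : (f v ∘ Sum.inl) = v := rfl
    rw [this]
    simp only [f, Sum.elim_inr, Matrix.cons_val_zero, Matrix.cons_val_one]
    field_simp
    ring
  have hself : ∀ z ∈ hyperboloid (Matrix.fromBlocks D 0 0 !![0, 1; 1, 0]), z (Sum.inr 1) = c →
      z ∈ Set.range f := by
    intro z hz hzc
    rw [hmem, hzc] at hz
    refine ⟨z ∘ Sum.inl, ?_⟩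
    ext i
    rcases i with i | i
    · rfl
    · fin_cases i
      · change (-1 - (z ∘ Sum.inl) ⬝ᵥ (D *ᵥ (z ∘ Sum.inl))) / (2 * c) = z (Sum.inr 0)
        rw [← hz]
        field_simp
        ring
      · exact hzc.symm
  exact (isPreconnected_range hf).subset_connectedComponentIn (hself x hx rfl) hrange
    (hself y hy hxy)

end Hyperboloid

/-! ### Signature of D ⊕ H₂ -/

section Signature

variable {n : ℕ}

/-- The form is positive on ℚⁿ plus the line of (1, 1) in H₂ and negative on the line of (1, -1).
These lower bounds already add up to n + 2, so both are equalities. -/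
lemma hasSignature_sumHyperbolicPlane {D : Matrix (Fin n) (Fin n) ℚ}
    (hD : ∀ x ≠ 0, 0 < x ⬝ᵥ (D *ᵥ x)) : HasSignature (sumHyperbolicPlane D) (n + 1) 1 := by
  set q := (sumHyperbolicPlane D).toQuadraticForm' with hq
  have hqx : ∀ x, q x = (x ∘ Sum.inl) ⬝ᵥ (D *ᵥ (x ∘ Sum.inl)) +
      2 * (x (Sum.inr 0) * x (Sum.inr 1)) := by
    intro x
    rw [← dotProduct_fromBlocks_mulVec]
    simp [hq, Matrix.toQuadraticForm', Matrix.toLinearMap₂'_apply',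
      sumHyperbolicPlane]
  have hD0 : ∀ x, 0 ≤ x ⬝ᵥ (D *ᵥ x) := fun x => by
    rcases eq_or_ne x 0 with rfl | hx
    · simp
    · exact (hD x hx).le
  have hpos : n + 1 ≤ sigPos q := by
    let f : ((Fin n → ℚ) × ℚ) →ₗ[ℚ] (Fin n ⊕ Fin 2 → ℚ) :=
      { toFun := fun p => Sum.elim p.1 ![p.2, p.2]
        map_add' := by
          intro a b; ext i; rcases i with i | i
          · rfl
          · fin_cases i <;> rfl
        map_smul' := by
          intro a b; ext i; rcases i with i | i
          · rfl
          · fin_cases i <;> rfl }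
    have hf : Function.Injective f := by
      intro a b hab
      refine Prod.ext ?_ (congrFun hab (Sum.inr 0))
      ext i
      exact congrFun hab (Sum.inl i)
    have hrank : Module.finrank ℚ (LinearMap.range f) = n + 1 := by
      rw [LinearMap.finrank_range_of_inj hf]; simp
    rw [← hrank]
    refine le_sigPos_of_posDef q ?_
    rintro ⟨_, p, rfl⟩ hp
    change 0 < q (f p)
    rw [hqx]
    change 0 < p.1 ⬝ᵥ (D *ᵥ p.1) + 2 * (p.2 * p.2)
    by_cases h1 : p.1 = 0
    · have h2 : p.2 ≠ 0 := fun h2 => hp (Subtype.ext (by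
        change f p = 0
        rw [show p = 0 from Prod.ext h1 h2, map_zero]))
      have := hD0 p.1
      have := mul_self_pos.2 h2
      linarith
    · have := hD _ h1
      nlinarith [mul_self_nonneg p.2]
  have hneg : 1 ≤ sigNeg q := by
    let v : Fin n ⊕ Fin 2 → ℚ := Sum.elim 0 ![1, -1]
    have hv : v ≠ 0 := fun h => one_ne_zero (congrFun h (Sum.inr 0) : (1 : ℚ) = 0)
    rw [← finrank_span_singleton (K := ℚ) hv]
    refine le_sigNeg_of_negDef q ?_
    rintro ⟨w, hw⟩ hw0
    obtain ⟨a, rfl⟩ := Submodule.mem_span_singleton.1 hw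
    have ha : a ≠ 0 := fun h => hw0 (Subtype.ext (by simp [h]))
    change 0 < (-q) (a • v)
    rw [_root_.neg_apply, QuadraticMap.map_smul, hqx]
    have h0 : v ∘ Sum.inl = 0 := rfl
    rw [h0]
    simp [v]
    positivity
  have hsum := QuadraticForm.sigPos_add_sigNeg_add_radical (Q := q)
  have hdim : Module.finrank ℚ (Fin n ⊕ Fin 2 → ℚ) = n + 2 := by simp
  rw [hdim] at hsum
  refine ⟨by simp, ?_, ?_⟩
  · change sigPos q = n + 1
    omega
  · change sigNeg q = 1
    omega

end Signature

/-! ### Invariant forms and the affine and Lorentzian representations -/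

section Cocycle

variable {n : ℕ} {G : Type*} [Group G]

/-- A representation with finite image preserves a positive definite integral form. -/
lemma exists_invariant_form (A : G →* Matrix (Fin n) (Fin n) ℤ) (hA : (Set.range A).Finite) :
    ∃ F : Matrix (Fin n) (Fin n) ℤ, F.IsSymm ∧ (∀ g, (A g)ᵀ * F * A g = F) ∧
      (F.map ((↑) : ℤ → ℝ)).PosDef := by
  classical
  refine ⟨∑ h ∈ hA.toFinset, hᵀ * h, ?_, fun g => ?_, ?_⟩
  · rw [Matrix.IsSymm, Matrix.transpose_sum]
    simp [Matrix.transpose_mul]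
  · rw [Finset.mul_sum, Finset.sum_mul]
    refine Finset.sum_nbij' (fun h => h * A g) (fun h => h * A g⁻¹) ?_ ?_ ?_ ?_ ?_
    · intro h hh
      rw [Set.Finite.mem_toFinset] at hh ⊢
      obtain ⟨k, rfl⟩ := hh
      exact ⟨k * g, map_mul _ _ _⟩
    · intro h hh
      rw [Set.Finite.mem_toFinset] at hh ⊢
      obtain ⟨k, rfl⟩ := hh
      exact ⟨k * g⁻¹, map_mul _ _ _⟩
    · intro h _
      rw [Matrix.mul_assoc, ← map_mul, mul_inv_cancel, map_one, Matrix.mul_one]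
    · intro h _
      rw [Matrix.mul_assoc, ← map_mul, inv_mul_cancel, map_one, Matrix.mul_one]
    · intro h _
      simp only [Matrix.transpose_mul, Matrix.mul_assoc]
  · have h1 : (1 : Matrix (Fin n) (Fin n) ℤ) ∈ hA.toFinset := by
      rw [Set.Finite.mem_toFinset]
      exact ⟨1, map_one A⟩
    have hmap : (∑ h ∈ hA.toFinset, hᵀ * h).map ((↑) : ℤ → ℝ) =
        ∑ h ∈ hA.toFinset, (h.map ((↑) : ℤ → ℝ))ᴴ * h.map ((↑) : ℤ → ℝ) := by
      change (Int.castRingHom ℝ).mapMatrix _ = _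
      rw [map_sum]
      refine Finset.sum_congr rfl fun h _ => ?_
      rw [map_mul, Matrix.conjTranspose_eq_transpose_of_trivial]
      rfl
    -- The summand of the identity is definite; the others need only be semidefinite.
    rw [hmap, ← Finset.add_sum_erase _ _ h1]
    refine Matrix.PosDef.add_posSemidef ?_
      (Matrix.posSemidef_sum _ fun h _ => Matrix.posSemidef_conjTranspose_mul_self _)
    rw [Matrix.map_one _ Int.cast_zero Int.cast_one]
    simpa using Matrix.PosDef.one

variable (A : G →* Matrix (Fin n) (Fin n) ℤ) (τ : G → Fin n → ℤ)

/-- The affine representation `g ↦ (A g, τ g; 0, 1)` given by a linear representation `A` and a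
cocycle `τ`. -/
def affineHom (hτ : ∀ g h, τ (g * h) = τ g + A g *ᵥ τ h) :
    G →* Matrix (Fin n ⊕ Fin 1) (Fin n ⊕ Fin 1) ℤ where
  toFun g := Matrix.fromBlocks (A g) (Matrix.of fun i _ => τ g i) 0 1
  map_one' := by
    have h1 : τ 1 = 0 := by simpa using hτ 1 1
    rw [map_one, h1, ← Matrix.fromBlocks_one]
    rfl
  map_mul' g h := by
    rw [Matrix.fromBlocks_multiply, map_mul, hτ]
    congr 1
    · simp
    · ext i j
      simp [Matrix.mulVec, dotProduct, Matrix.mul_apply, add_comm]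
    · simp
    · simp

/-- The representation into the stabilizer of a light-like vector of the form `(2 F)⁻¹ ⊕ H₂`
that extends the contragredient of the affine representation `(A, τ)`. -/
def lorentzHom (hτ : ∀ g h, τ (g * h) = τ g + A g *ᵥ τ h) {F : Matrix (Fin n) (Fin n) ℤ}
    (hFs : F.IsSymm) (hF : ∀ g, (A g)ᵀ * F * A g = F) :
    G →* Matrix (Fin n ⊕ Fin 2) (Fin n ⊕ Fin 2) ℤ where
  -- For D = (2F)⁻¹ and u = 2Fτ one has Du = τ, and isotropy of the last column forces s = -uᵀDu/2 =
  -- -τᵀFτ. The factor 2 is what keeps s integral.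
  toFun g := shearMatrix (A g⁻¹)ᵀ ((2 : ℤ) • (F *ᵥ τ g)) (τ g⁻¹) (-(τ g ⬝ᵥ (F *ᵥ τ g)))
  map_one' := by
    have h1 : τ 1 = 0 := by simpa using hτ 1 1
    simp [h1, shearMatrix_one]
  map_mul' g h := by
    have h1 : τ 1 = 0 := by simpa using hτ 1 1
    have hFA : F * A g = (A g⁻¹)ᵀ * F := by
      conv_lhs => rw [← hF g⁻¹]
      rw [Matrix.mul_assoc, ← map_mul, inv_mul_cancel, map_one, Matrix.mul_one]
    have hinv : A g⁻¹ *ᵥ τ g = -τ g⁻¹ := by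
      have := hτ g⁻¹ g
      rw [inv_mul_cancel, h1] at this
      exact (neg_eq_of_add_eq_zero_right this.symm).symm
    have hsymm : ∀ x y : Fin n → ℤ, x ⬝ᵥ (F *ᵥ y) = y ⬝ᵥ (F *ᵥ x) := fun x y => by
      rw [Matrix.dotProduct_mulVec, dotProduct_comm, ← Matrix.mulVec_transpose, hFs.eq]
    -- The cross term of the quadratic entry at gh; it occurs twice and matches the product of the
    -- middle row of g with the last column of h.
    have hcross : τ g ⬝ᵥ (F *ᵥ (A g *ᵥ τ h)) = -(τ g⁻¹ ⬝ᵥ (F *ᵥ τ h)) := by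
      rw [Matrix.mulVec_mulVec, hFA, ← Matrix.mulVec_mulVec, Matrix.dotProduct_mulVec,
        Matrix.vecMul_transpose, hinv, neg_dotProduct]
    rw [shearMatrix_mul, mul_inv_rev, map_mul, Matrix.transpose_mul, hτ g h, hτ h⁻¹ g⁻¹]
    congr 1
    · rw [Matrix.mulVec_smul, Matrix.mulVec_mulVec, ← hFA, Matrix.mulVec_add, smul_add,
        Matrix.mulVec_mulVec]
    · rw [Matrix.vecMul_transpose, add_comm]
    · rw [Matrix.mulVec_add, add_dotProduct, dotProduct_add, dotProduct_add, hcross,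
        hsymm (A g *ᵥ τ h) (τ g), hcross, dotProduct_smul, smul_eq_mul]
      have : (A g *ᵥ τ h) ⬝ᵥ (F *ᵥ (A g *ᵥ τ h)) = τ h ⬝ᵥ (F *ᵥ τ h) := by
        conv_rhs => rw [← hF g, ← Matrix.mulVec_mulVec, ← Matrix.mulVec_mulVec,
          Matrix.dotProduct_mulVec, Matrix.vecMul_transpose]
      rw [this]
      ring

end Cocycle

/-! ### The dual form (2F)⁻¹ and its invariance -/

section DualForm

variable {n : ℕ} {F : Matrix (Fin n) (Fin n) ℤ}

/-- The inverse `(2 F)⁻¹` of a nondegenerate even integral form. -/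
def dualForm (F : Matrix (Fin n) (Fin n) ℤ) : Matrix (Fin n) (Fin n) ℚ :=
  ((2 : ℚ) • F.map ((↑) : ℤ → ℚ))⁻¹

lemma map_two_smul_map (F : Matrix (Fin n) (Fin n) ℤ) :
    ((2 : ℚ) • F.map ((↑) : ℤ → ℚ)).map ((↑) : ℚ → ℝ) = (2 : ℝ) • F.map ((↑) : ℤ → ℝ) := by
  ext i j
  simp

lemma dualForm_map (hF : (F.map ((↑) : ℤ → ℝ)).PosDef) :
    (dualForm F).map ((↑) : ℚ → ℝ) = ((2 : ℝ) • F.map ((↑) : ℤ → ℝ))⁻¹ := by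
  have hdet : IsUnit ((2 : ℚ) • F.map ((↑) : ℤ → ℚ)).det := by
    have h := (Matrix.isUnit_iff_isUnit_det _).1 (hF.smul (two_pos : (0 : ℝ) < 2)).isUnit
    rw [← map_two_smul_map] at h
    have h' := (Rat.castHom ℝ).map_det ((2 : ℚ) • F.map ((↑) : ℤ → ℚ))
    rw [isUnit_iff_ne_zero] at h ⊢
    intro h0
    rw [h0, map_zero] at h'
    exact h h'.symm
  refine (Matrix.inv_eq_left_inv ?_).symm
  rw [← map_two_smul_map]
  change (Rat.castHom ℝ).mapMatrix (dualForm F) * (Rat.castHom ℝ).mapMatrix _ = 1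
  rw [← map_mul, dualForm, Matrix.nonsing_inv_mul _ hdet, map_one]

lemma posDef_dualForm_map (hF : (F.map ((↑) : ℤ → ℝ)).PosDef) :
    ((dualForm F).map ((↑) : ℚ → ℝ)).PosDef := by
  rw [dualForm_map hF]
  exact (hF.smul (two_pos : (0 : ℝ) < 2)).inv

lemma dualForm_map_mul (hF : (F.map ((↑) : ℤ → ℝ)).PosDef) :
    (dualForm F).map ((↑) : ℚ → ℝ) * ((2 : ℝ) • F.map ((↑) : ℤ → ℝ)) = 1 := by
  rw [dualForm_map hF]
  exact Matrix.nonsing_inv_mul _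
    ((Matrix.isUnit_iff_isUnit_det _).1 (hF.smul (two_pos : (0 : ℝ) < 2)).isUnit)

lemma isSymm_dualForm (hFs : F.IsSymm) : (dualForm F).IsSymm := by
  rw [Matrix.IsSymm, dualForm, Matrix.transpose_nonsing_inv, Matrix.transpose_smul,
    ← Matrix.transpose_map, hFs.eq]

lemma dotProduct_dualForm_mulVec_pos (hF : (F.map ((↑) : ℤ → ℝ)).PosDef) (x : Fin n → ℚ)
    (hx : x ≠ 0) : 0 < x ⬝ᵥ (dualForm F *ᵥ x) := by
  have hx' : (fun i => (x i : ℝ)) ≠ 0 := fun h => hx (funext fun i =>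
    Rat.cast_eq_zero.1 (congrFun h i))
  have h := (posDef_dualForm_map hF).dotProduct_mulVec_pos hx'
  have h2 : star (fun i => (x i : ℝ)) ⬝ᵥ ((dualForm F).map ((↑) : ℚ → ℝ) *ᵥ fun i => (x i : ℝ)) =
      ((x ⬝ᵥ (dualForm F *ᵥ x) : ℚ) : ℝ) := by
    simp [dotProduct, Matrix.mulVec]
  rw [h2] at h
  exact_mod_cast h

/-- Inverting BᵀFB = F: both sides are inverse to 2F. This is why the transposed holonomy preserves
D. -/
lemma mul_dualForm_map_mul_transpose (hF : (F.map ((↑) : ℤ → ℝ)).PosDef)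
    {B B' : Matrix (Fin n) (Fin n) ℤ} (hB : Bᵀ * F * B = F) (hBB : B * B' = 1) :
    B.map ((↑) : ℤ → ℝ) * (dualForm F).map ((↑) : ℚ → ℝ) * (B.map ((↑) : ℤ → ℝ))ᵀ =
      (dualForm F).map ((↑) : ℚ → ℝ) := by
  set f := (Int.castRingHom ℝ).mapMatrix (m := Fin n)
  change f B * _ * (f B)ᵀ = _
  have hBB' : f B * f B' = 1 := by rw [← map_mul, hBB, map_one]
  have hB' : (f B)ᵀ * f F * f B = f F := by
    have : (f B)ᵀ = f Bᵀ := rfl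
    rw [this, ← map_mul, ← map_mul, hB]
  have hDF : (dualForm F).map ((↑) : ℚ → ℝ) * ((2 : ℝ) • f F) = 1 := dualForm_map_mul hF
  have hFD : ((2 : ℝ) • f F) * (dualForm F).map ((↑) : ℚ → ℝ) = 1 :=
    mul_eq_one_comm.1 hDF
  set D := (dualForm F).map ((↑) : ℚ → ℝ)
  have h1 : f B * D * (f B)ᵀ * ((2 : ℝ) • f F) = 1 := by
    calc f B * D * (f B)ᵀ * ((2 : ℝ) • f F)
        = f B * D * (f B)ᵀ * ((2 : ℝ) • f F) * (f B * f B') := by rw [hBB', Matrix.mul_one]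
      _ = f B * (D * ((2 : ℝ) • ((f B)ᵀ * f F * f B))) * f B' := by
          simp only [Matrix.mul_assoc, Matrix.smul_mul, Matrix.mul_smul]
      _ = 1 := by rw [hB', hDF, Matrix.mul_one, hBB']
  calc f B * D * (f B)ᵀ = f B * D * (f B)ᵀ * (((2 : ℝ) • f F) * D) := by
        rw [hFD, Matrix.mul_one]
    _ = D := by rw [← Matrix.mul_assoc, h1, Matrix.one_mul]

variable {G : Type*} [Group G] (A : G →* Matrix (Fin n) (Fin n) ℤ) (τ : G → Fin n → ℤ)

lemma sumHyperbolicPlane_map (D : Matrix (Fin n) (Fin n) ℚ) :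
    (sumHyperbolicPlane D).map ((↑) : ℚ → ℝ) =
      Matrix.fromBlocks (D.map ((↑) : ℚ → ℝ)) 0 0 !![0, 1; 1, 0] := by
  rw [sumHyperbolicPlane, Matrix.fromBlocks_map]
  congr 1
  · ext; simp
  · ext; simp
  · ext i j; fin_cases i <;> fin_cases j <;> simp

lemma lorentzHom_mem (hτ : ∀ g h, τ (g * h) = τ g + A g *ᵥ τ h) (hFs : F.IsSymm)
    (hF : ∀ g, (A g)ᵀ * F * A g = F) (hpos : (F.map ((↑) : ℤ → ℝ)).PosDef) (g : G) :
    (lorentzHom A τ hτ hFs hF).toHomUnits g ∈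
      integralOrthogonalZero (sumHyperbolicPlane (dualForm F)) := by
  rw [integralOrthogonalZero, Subgroup.mem_comap, sumHyperbolicPlane_map]
  set D := (dualForm F).map ((↑) : ℚ → ℝ) with hD
  set X := Matrix.GeneralLinearGroup.map (Int.castRingHom ℝ)
    ((lorentzHom A τ hτ hFs hF).toHomUnits g)
  have hX : (X : Matrix (Fin n ⊕ Fin 2) (Fin n ⊕ Fin 2) ℝ) =
      shearMatrix ((A g⁻¹)ᵀ.map (Int.castRingHom ℝ))
        (Int.castRingHom ℝ ∘ ((2 : ℤ) • (F *ᵥ τ g))) (Int.castRingHom ℝ ∘ τ g⁻¹)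
        (Int.castRingHom ℝ (-(τ g ⬝ᵥ (F *ᵥ τ g)))) :=
    shearMatrix_map (Int.castRingHom ℝ) _ _ _ _
  have hu : Int.castRingHom ℝ ∘ ((2 : ℤ) • (F *ᵥ τ g)) =
      ((2 : ℝ) • F.map ((↑) : ℤ → ℝ)) *ᵥ (Int.castRingHom ℝ ∘ τ g) := by
    ext i
    simp [Matrix.mulVec, dotProduct, Finset.mul_sum, mul_assoc]
  have hDu : D *ᵥ (Int.castRingHom ℝ ∘ ((2 : ℤ) • (F *ᵥ τ g))) = Int.castRingHom ℝ ∘ τ g := by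
    rw [hu, Matrix.mulVec_mulVec, dualForm_map_mul hpos, Matrix.one_mulVec]
  have hinv : A g⁻¹ *ᵥ τ g = -τ g⁻¹ := by
    have h1 : τ 1 = 0 := by simpa using hτ 1 1
    have := hτ g⁻¹ g
    rw [inv_mul_cancel, h1] at this
    exact (neg_eq_of_add_eq_zero_right this.symm).symm
  have hXmem : X ∈ realOrthogonal (Matrix.fromBlocks D 0 0 !![0, 1; 1, 0]) := by
    change (X : Matrix (Fin n ⊕ Fin 2) (Fin n ⊕ Fin 2) ℝ)ᵀ * _ *
      (X : Matrix (Fin n ⊕ Fin 2) (Fin n ⊕ Fin 2) ℝ) = _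
    rw [hX]
    refine shearMatrix_transpose_mul_mul ?_ ?_ ?_ ?_
    · rw [hD, Matrix.IsSymm, ← Matrix.transpose_map, (isSymm_dualForm hFs).eq]
    · exact mul_dualForm_map_mul_transpose hpos (B := A g⁻¹) (B' := A g) (hF g⁻¹)
        (by rw [← map_mul, inv_mul_cancel, map_one])
    · rw [hDu]
      ext i
      have := congrArg (Int.castRingHom ℝ) (congrFun hinv i)
      simpa [Matrix.mulVec, dotProduct] using this
    · rw [hDu]
      simp only [dotProduct, Function.comp_apply, Pi.smul_apply, smul_eq_mul, map_mul, map_neg,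
        map_sum, map_ofNat, mul_neg, Finset.mul_sum, ← Finset.sum_neg_distrib,
        ← Finset.sum_add_distrib]
      exact Finset.sum_eq_zero fun i _ => by ring
  refine ⟨hXmem, fun x hx => mem_connectedComponentIn_hyperboloid (posDef_dualForm_map hpos) hx
    (realOrthogonal_mulVec_mem hXmem hx) ?_⟩
  rw [hX, shearMatrix_mulVec_inr_one]

end DualForm

/-! ### Integral structure of a Bieberbach group -/

section Integrality

/-- The element g h⁻¹ is the translation by g 0 - h 0. -/
lemma sub_apply_zero_mem_translationLattice {E : Type*} [NormedAddCommGroup E] [NormedSpace ℝ E]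
    {Γ : Subgroup (E ≃ᵢ E)} {g h : E ≃ᵢ E} (hg : g ∈ Γ) (hh : h ∈ Γ)
    (hgh : g.linPart = h.linPart) : g 0 - h 0 ∈ translationLattice Γ := by
  refine ⟨g * h⁻¹, Γ.mul_mem hg (Γ.inv_mem hh), fun x => ?_⟩
  rw [mul_apply, apply_eq_linPart_add g, hgh, apply_eq_linPart_add h⁻¹, inv_apply_zero, map_add,
    map_neg, linPart_linPart_inv_apply, linPart_linPart_inv_apply]
  abel

/-- If the holonomy is finite, there is a point whose orbit lies, up to a fixed multiple, in its
translates by the translation lattice. -/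
lemma exists_smul_apply_sub_mem_translationLattice {E : Type*} [NormedAddCommGroup E]
    [NormedSpace ℝ E] {Γ : Subgroup (E ≃ᵢ E)} (hH : (linPart '' (Γ : Set (E ≃ᵢ E))).Finite) :
    ∃ (c : E) (N : ℕ), 0 < N ∧ ∀ g ∈ Γ, (N : ℝ) • (g c - c) ∈ translationLattice Γ := by
  classical
  set H := hH.toFinset with hHdef
  have hmem : ∀ T, T ∈ H ↔ ∃ g ∈ Γ, g.linPart = T := fun T => by
    rw [hHdef, Set.Finite.mem_toFinset]
    rfl
  choose! r hr hrT using fun T (hT : T ∈ H) => (hmem T).1 hT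
  have hcard : 0 < H.card := Finset.card_pos.2 ⟨1, (hmem 1).2 ⟨1, Γ.one_mem, linPart_one⟩⟩
  have hcard' : (H.card : ℝ) ≠ 0 := by exact_mod_cast hcard.ne'
  -- The centroid of one orbit point of 0 per holonomy element. Applying g permutes the holonomy
  -- classes, so each point lands on another chosen one up to a lattice vector, and N = |H| clears
  -- the averaging denominator.
  refine ⟨(H.card : ℝ)⁻¹ • ∑ T ∈ H, r T 0, H.card, hcard, fun g hg => ?_⟩
  set c : E := (H.card : ℝ)⁻¹ • ∑ T ∈ H, r T 0 with hc
  have h1 : (H.card : ℝ) • c = ∑ T ∈ H, r T 0 := by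
    rw [hc, smul_inv_smul₀ hcard']
  have h2 : (H.card : ℝ) • g c = ∑ T ∈ H, (g * r T) 0 := by
    rw [apply_eq_linPart_add g c, smul_add, ← map_smul, h1, map_sum, Nat.cast_smul_eq_nsmul,
      ← Finset.sum_const, ← Finset.sum_add_distrib]
    exact Finset.sum_congr rfl fun T _ => (apply_eq_linPart_add g _).symm
  have hgmem : ∀ k ∈ Γ, ∀ T ∈ H, k.linPart * T ∈ H := by
    intro k hk T hT
    obtain ⟨l, hl, rfl⟩ := (hmem T).1 hT
    exact (hmem _).2 ⟨k * l, Γ.mul_mem hk hl, linPart_mul _ _⟩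
  have h3 : ∑ T ∈ H, r T 0 = ∑ T ∈ H, r (g.linPart * T) 0 := by
    refine (Finset.sum_nbij' (fun T => g.linPart * T) (fun T => g⁻¹.linPart * T) (hgmem g hg)
      (hgmem _ (Γ.inv_mem hg)) ?_ ?_ ?_).symm
    · intro T _
      rw [← mul_assoc, linPart_inv_mul_linPart, one_mul]
    · intro T _
      rw [← mul_assoc, linPart_mul_linPart_inv, one_mul]
    · intro T _
      rfl
  rw [smul_sub, h1, h2, h3, ← Finset.sum_sub_distrib]
  refine Submodule.sum_mem _ fun T hT => ?_
  refine sub_apply_zero_mem_translationLattice (Γ.mul_mem hg (hr T hT)) (hr _ (hgmem g hg T hT)) ?_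
  rw [linPart_mul, hrT T hT, hrT _ (hgmem g hg T hT)]

variable {n : ℕ} {Γ : Subgroup (EucIsom n)}

lemma linearPart_apply_eq (g : EucIsom n) (x : Euc n) : linearPart g x = g.linPart x := rfl

lemma linearPart_mul (g h : EucIsom n) :
    linearPart (g * h) = linearPart g * linearPart h := by
  ext1 x
  rw [linearPart_apply_eq, linPart_mul]
  rfl

lemma linearPart_one : linearPart (1 : EucIsom n) = 1 := by
  ext1 x
  rw [linearPart_apply_eq, linPart_one]
  rfl

/-- The holonomy representation on the translation lattice, as integral matrices. -/
lemma exists_holonomyHom {b : Module.Basis (Fin n) ℝ (Euc n)}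
    (hb : IsTranslationBasis Γ b) :
    ∃ A : Γ →* Matrix (Fin n) (Fin n) ℤ, ∀ g : Γ, (A g).map ((↑) : ℤ → ℝ) =
      LinearMap.toMatrix b b (linearPart (g : EucIsom n)) := by
  have hM : ∀ g : Γ, ∃ M : Matrix (Fin n) (Fin n) ℤ, M.map ((↑) : ℤ → ℝ) =
      LinearMap.toMatrix b b (linearPart (g : EucIsom n)) := by
    intro g
    have hij : ∀ i j, ∃ k : ℤ, (k : ℝ) = b.repr (linearPart (g : EucIsom n) (b j)) i := by
      intro i j
      have hj := (hb _).1 (Submodule.subset_span ⟨j, rfl⟩ :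
        b j ∈ Submodule.span ℤ (Set.range b))
      have hj' := (hb _).2 (mem_translationLattice.1 (linPart_mem_translationLattice g.2 hj))
      exact (b.mem_span_iff_repr_mem ℤ _).1 hj' i
    choose M hM using hij
    refine ⟨Matrix.of M, ?_⟩
    ext i j
    rw [LinearMap.toMatrix_apply]
    exact hM i j
  choose A hA using hM
  have hinj : Function.Injective fun M : Matrix (Fin n) (Fin n) ℤ => M.map ((↑) : ℤ → ℝ) :=
    Matrix.map_injective Int.cast_injective
  refine ⟨{ toFun := A, map_one' := hinj ?_, map_mul' := fun g h => hinj ?_ }, hA⟩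
  · change (A 1).map _ = (1 : Matrix (Fin n) (Fin n) ℤ).map _
    rw [hA, Matrix.map_one _ Int.cast_zero Int.cast_one, Subgroup.coe_one, linearPart_one]
    exact LinearMap.toMatrix_one b
  · have h1 : (A g * A h).map ((↑) : ℤ → ℝ) =
        (A g).map ((↑) : ℤ → ℝ) * (A h).map ((↑) : ℤ → ℝ) :=
      Matrix.map_mul (f := Int.castRingHom ℝ)
    change (A (g * h)).map _ = (A g * A h).map _
    rw [h1, hA, hA, hA, Subgroup.coe_mul, linearPart_mul, LinearMap.toMatrix_mul]

/-- The translation part of a group of isometries in suitable affine coordinates is an integral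
cocycle. -/
lemma exists_translationCocycle {b : Module.Basis (Fin n) ℝ (Euc n)}
    (hb : IsTranslationBasis Γ b) {c : Euc n} {N : ℕ}
    (hc : ∀ g ∈ Γ, (N : ℝ) • (g c - c) ∈ translationLattice Γ)
    {A : Γ →* Matrix (Fin n) (Fin n) ℤ} (hA : ∀ g : Γ, (A g).map ((↑) : ℤ → ℝ) =
      LinearMap.toMatrix b b (linearPart (g : EucIsom n))) :
    ∃ τ : Γ → Fin n → ℤ, (∀ g i, (τ g i : ℝ) = N * b.repr ((g : EucIsom n) c - c) i) ∧
      ∀ g h, τ (g * h) = τ g + A g *ᵥ τ h := by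
  have hk : ∀ (g : Γ) (i : Fin n), ∃ k : ℤ, (k : ℝ) = N * b.repr ((g : EucIsom n) c - c) i := by
    intro g i
    obtain ⟨k, hk⟩ := (b.mem_span_iff_repr_mem ℤ _).1
      ((hb _).2 (mem_translationLattice.1 (hc g g.2))) i
    refine ⟨k, ?_⟩
    rw [map_smul] at hk
    exact hk
  choose τ hτ using hk
  refine ⟨τ, hτ, fun g h => ?_⟩
  ext i
  have h1 : ((g * h : Γ) : EucIsom n) c - c =
      ((g : EucIsom n) c - c) + linearPart (g : EucIsom n) ((h : EucIsom n) c - c) := by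
    rw [linearPart_apply_eq, ← apply_sub_apply, Subgroup.coe_mul, mul_apply]
    abel
  have h2 := congrFun (LinearMap.toMatrix_mulVec_repr b b (linearPart (g : EucIsom n))
    ((h : EucIsom n) c - c)) i
  rw [← hA] at h2
  have h3 : ((τ (g * h) i : ℤ) : ℝ) = ((τ g i + (A g *ᵥ τ h) i : ℤ) : ℝ) := by
    push_cast
    rw [hτ, hτ, h1, map_add, Finsupp.add_apply, ← h2, mul_add]
    simp [Matrix.mulVec, dotProduct, hτ, Finset.mul_sum, mul_left_comm]
  exact_mod_cast h3

/-- **Bieberbach's first theorem**: the translations in a Bieberbach group form a full lattice. -/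
lemma IsBieberbachGroup.exists_isTranslationBasis (hΓ : IsBieberbachGroup Γ) :
    ∃ b : Module.Basis (Fin n) ℝ (Euc n), IsTranslationBasis Γ b := by
  obtain ⟨R, hR⟩ := exists_norm_apply_zero_sub_le hΓ.cocompact
  have := discreteTopology_translationLattice hΓ.finite_norm_le
  have : IsZLattice ℝ (translationLattice Γ) := ⟨span_translationLattice hΓ.finite_norm_le hR⟩
  have := ZLattice.module_free ℝ (translationLattice Γ)
  have := ZLattice.module_finite ℝ (translationLattice Γ)
  have hrank : Module.finrank ℤ (translationLattice Γ) = n := by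
    rw [ZLattice.rank ℝ (translationLattice Γ)]
    simp
  refine ⟨(Module.finBasisOfFinrankEq ℤ (translationLattice Γ) hrank).ofZLatticeBasis ℝ
    (translationLattice Γ), fun t => ?_⟩
  rw [Module.Basis.ofZLatticeBasis_span]
  rfl

lemma finite_range_of_map_eq_toMatrix {b : Module.Basis (Fin n) ℝ (Euc n)}
    (hH : (linPart '' (Γ : Set (EucIsom n))).Finite)
    {A : Γ →* Matrix (Fin n) (Fin n) ℤ} (hA : ∀ g : Γ, (A g).map ((↑) : ℤ → ℝ) =
      LinearMap.toMatrix b b (linearPart (g : EucIsom n))) : (Set.range A).Finite := by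
  refine Set.Finite.of_finite_image (f := fun M => M.map ((↑) : ℤ → ℝ)) ?_
    (Matrix.map_injective Int.cast_injective).injOn
  refine (hH.image fun T : Euc n →L[ℝ] Euc n =>
    LinearMap.toMatrix b b (T : Euc n →ₗ[ℝ] Euc n)).subset ?_
  rintro _ ⟨_, ⟨g, rfl⟩, rfl⟩
  exact ⟨_, ⟨g, g.2, rfl⟩, (hA g).symm⟩

lemma affineMatrix_injective {b : Module.Basis (Fin n) ℝ (Euc n)} {c : Euc n} {N : ℕ}
    (hN : 0 < N) : Function.Injective (affineMatrix b c N) := by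
  intro g h hgh
  obtain ⟨h1, h2, -, -⟩ := Matrix.fromBlocks_inj.1 hgh
  have h3 : g.linPart = h.linPart := by
    ext1 x
    rw [← linearPart_apply_eq, (LinearMap.toMatrix b b).injective h1, linearPart_apply_eq]
  have h4 : g c = h c := by
    refine sub_left_injective (b := c) (b.ext_elem fun i => ?_)
    have h5 : (N : ℝ) * b.repr (g c - c) i = N * b.repr (h c - c) i := congrFun (congrFun h2 i) 0
    exact mul_left_cancel₀ (by exact_mod_cast hN.ne') h5
  refine ext_linPart h3 ?_
  rw [apply_eq_linPart_add g, apply_eq_linPart_add h, h3] at h4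
  exact add_left_cancel h4

end Integrality

end

theorem theorem1p2 (n : ℕ) (Γ : Subgroup (EucIsom n)) (hΓ : IsBieberbachGroup Γ)
    (x : OrbitSpace Γ) :
    ∃ (Q : Matrix (Fin n ⊕ Fin 2) (Fin n ⊕ Fin 2) ℚ)
      (ρ : FundamentalGroup (OrbitSpace Γ) x →* integralOrthogonalZero Q),
      -- the embedding
      Q.IsSymm ∧ HasSignature Q (n + 1) 1 ∧ Function.Injective ρ ∧
      -- the image fixes a light-like vector
      (∃ v : Fin n ⊕ Fin 2 → ℤ, v ≠ 0 ∧
        (fun i => (v i : ℚ)) ⬝ᵥ (Q *ᵥ (fun i => (v i : ℚ))) = 0 ∧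
        ∀ g, ((ρ g).1 : Matrix (Fin n ⊕ Fin 2) (Fin n ⊕ Fin 2) ℤ) *ᵥ v = v) ∧
      -- the shape of the form and of the embedding
      ∃ (e : FundamentalGroup (OrbitSpace Γ) x ≃* Γ)
        (b : Module.Basis (Fin n) ℝ (Euc n)) (c : Euc n) (N : ℕ)
        (Φ : Γ →* GL (Fin n ⊕ Fin 1) ℤ) (D : Matrix (Fin n) (Fin n) ℚ),
        IsTranslationBasis Γ b ∧ 0 < N ∧
        (∀ g : Γ, (Φ g : Matrix (Fin n ⊕ Fin 1) (Fin n ⊕ Fin 1) ℤ).map ((↑) : ℤ → ℝ) =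
          affineMatrix b c N (g : EucIsom n)) ∧
        (D.map ((↑) : ℚ → ℝ)).PosDef ∧ IsHolonomyInvariant Γ b D ∧
        RatEquivalent Q (sumHyperbolicPlane D) ∧
        ∀ g, (((ρ g).1 : Matrix (Fin n ⊕ Fin 2) (Fin n ⊕ Fin 2) ℤ).submatrix
              (firstCoords n) (firstCoords n) =
            (((Φ (e g))⁻¹ : GL (Fin n ⊕ Fin 1) ℤ) :
              Matrix (Fin n ⊕ Fin 1) (Fin n ⊕ Fin 1) ℤ)ᵀ) ∧
          (∀ j, ((ρ g).1 : Matrix (Fin n ⊕ Fin 2) (Fin n ⊕ Fin 2) ℤ) (Sum.inr 1) j =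
            if j = Sum.inr 1 then 1 else 0) := by

  obtain ⟨b, hb⟩ := hΓ.exists_isTranslationBasis
  obtain ⟨R, hR⟩ := exists_norm_apply_zero_sub_le hΓ.cocompact
  have hH := finite_image_linPart hΓ.finite_norm_le hR
  obtain ⟨c, N, hN, hc⟩ := exists_smul_apply_sub_mem_translationLattice hH
  obtain ⟨A, hA⟩ := exists_holonomyHom hb
  obtain ⟨τ, hτ, hcoc⟩ := exists_translationCocycle hb hc hA
  obtain ⟨F, hFs, hF, hpos⟩ := exists_invariant_form A (finite_range_of_map_eq_toMatrix hH hA)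
  obtain ⟨e⟩ := hΓ.nonempty_fundamentalGroup_mulEquiv x
  let Φ : Γ →* GL (Fin n ⊕ Fin 1) ℤ := (affineHom A τ hcoc).toHomUnits
  let L : Γ →* GL (Fin n ⊕ Fin 2) ℤ := (lorentzHom A τ hcoc hFs hF).toHomUnits
  let ρ₀ : Γ →* integralOrthogonalZero (sumHyperbolicPlane (dualForm F)) :=
    L.codRestrict _ (lorentzHom_mem A τ hcoc hFs hF hpos)
  have hΦ : ∀ g : Γ, (Φ g : Matrix (Fin n ⊕ Fin 1) (Fin n ⊕ Fin 1) ℤ).map ((↑) : ℤ → ℝ) =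
      affineMatrix b c N (g : EucIsom n) := by
    intro g
    change (Matrix.fromBlocks (A g) (Matrix.of fun i _ => τ g i) 0 1).map _ = _
    rw [Matrix.fromBlocks_map, affineMatrix, hA]
    congr 1
    · ext i j
      exact hτ g i
    · ext i j
      simp
    · exact Matrix.map_one _ Int.cast_zero Int.cast_one
  have hLΦ : ∀ g : Γ, (L g : Matrix (Fin n ⊕ Fin 2) (Fin n ⊕ Fin 2) ℤ).submatrix
      (firstCoords n) (firstCoords n) = (((Φ g)⁻¹ : GL (Fin n ⊕ Fin 1) ℤ) :
        Matrix (Fin n ⊕ Fin 1) (Fin n ⊕ Fin 1) ℤ)ᵀ := by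
    intro g
    rw [← map_inv]
    change (shearMatrix _ _ _ _).submatrix _ _ =
      (Matrix.fromBlocks (A g⁻¹) (Matrix.of fun i _ => τ g⁻¹ i) 0 1)ᵀ
    ext i j
    rcases i with i | i <;> rcases j with j | j
    · rfl
    · rfl
    · rfl
    · rw [Subsingleton.elim i 0, Subsingleton.elim j 0]
      rfl
  have hΦinj : Function.Injective Φ := by
    intro g h hgh
    refine Subtype.ext (affineMatrix_injective (b := b) (c := c) hN ?_)
    rw [← hΦ, ← hΦ, hgh]
  -- The first n + 1 coordinates already recover Φ, which is faithful.
  have hρinj : Function.Injective ρ₀ := by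
    intro g h hgh
    refine hΦinj (inv_injective (Units.ext (Matrix.transpose_injective ?_)))
    have : L g = L h := congrArg Subtype.val hgh
    rw [← hLΦ, ← hLΦ, this]
  -- Q is D ⊕ H₂ itself, so the rational equivalence is the identity; the fixed light-like vector is
  -- the first basis vector of H₂.
  refine ⟨sumHyperbolicPlane (dualForm F), ρ₀.comp e.toMonoidHom, ?_,
    hasSignature_sumHyperbolicPlane (dotProduct_dualForm_mulVec_pos hpos),
    hρinj.comp e.injective, ⟨Pi.single (Sum.inr 0) 1, ?_, ?_, fun g => ?_⟩,
    e, b, c, N, Φ, dualForm F, hb, hN, hΦ, posDef_dualForm_map hpos, fun g hg => ?_,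
    ⟨1, by simp⟩, fun g => ⟨hLΦ (e g), fun j => ?_⟩⟩
  · rw [sumHyperbolicPlane, Matrix.isSymm_fromBlocks_iff]
    refine ⟨isSymm_dualForm hFs, by simp, by simp, ?_⟩
    ext i j
    fin_cases i <;> fin_cases j <;> rfl
  · simp
  · have hv : (fun i => ((Pi.single (Sum.inr 0) 1 : Fin n ⊕ Fin 2 → ℤ) i : ℚ)) =
        Pi.single (Sum.inr 0) 1 := by
      ext i
      simp [Pi.single_apply]
    rw [hv]
    simp [sumHyperbolicPlane]
  · change shearMatrix _ _ _ _ *ᵥ _ = _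
    ext i
    rcases i with i | i
    · simp [shearMatrix]
    · fin_cases i <;> simp [shearMatrix]
  · have h := mul_dualForm_map_mul_transpose hpos (hF ⟨g, hg⟩) (B' := A ⟨g, hg⟩⁻¹)
      (by rw [← map_mul, mul_inv_cancel, map_one])
    rw [hA] at h
    exact h
  · change shearMatrix _ _ _ _ _ _ = _
    rcases j with j | j
    · simp [shearMatrix]
    · fin_cases j <;> simp [shearMatrix]
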